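/- **Setup.** Let $(M,d_M)$ be a Riemannian manifold (only the structure of a Polish metric space with its Borel $\sigma$-algebra is used) and let $f:M\to M$ be a Borel measurable map (for instance a diffeomorphism, possibly with singularities). Let $Y\subset M$ be a measurable subset with a countable measurable partition $\{Y_j\}$, and let $r:Y\to\mathbb Z^+$ be constant on each $Y_j$ with $f^{r(y)}(y)\in Y$ for all $y\in Y$. Put $F(y)=f^{r(y)}(y)$, $F:Y\to Y$. The separation time $s(y,y')$ is the least $n\ge 0$ such that $F^ny,F^ny'$ lie in distinct partition elements. Let $\mathcal W^s$ be a measurable partition of $Y$ into "stable leaves" (the leaves are separated by countably many measurable unions of leaves) such that each $Y_j$ is a union of leaves; $W^s(y)$ denotes the leaf containing $y$. Let $W^u\subset Y$ be a measurable set that meets each leaf in exactly one point. Let $\mu_Y$ be an $F$-invariant ergodic probability measure on $Y$. Let $\bar Y=Y/\mathcal W^s$ be the quotient with the quotient $\sigma$-algebra, $\pi:Y\to\bar Y$ the projection, and $\bar\mu_Y=\pi_*\mu_Y$. Assume: * (A1) $F(W^s(y))\subset W^s(Fy)$ for all $y\in Y$. Hence there is a quotient map $\bar F:\bar Y\to\bar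 Y$ with $\bar F\circ\pi=\pi\circ F$. * (A2) There are constants $C\ge1$, $\gamma_0\in(0,1)$ such that for all $j\ge0$ and $0\le\ell\le r(F^jy)$: (i) $d_M(f^\ell F^jy,f^\ell F^jy')\le C\gamma_0^{\,j}$ for all $y\in Y$, $y'\in W^s(y)$; (ii) $d_M(f^\ell F^jy,f^\ell F^jy')\le C\gamma_0^{\,s(y,y')-j}$ for all $y,y'\in W^u$ with $s(y,y')<\infty$. * (A3) $\bar F$ is a mixing Gibbs–Markov map on $(\bar Y,\bar\mu_Y)$ with partition $\alpha=\{\pi(Y_j)\}$. That is: $\bar F$ is ergodic and preserves $\bar\mu_Y$; $\bar\mu_Y(A\cap\bar F^{-n}B)\to\bar\mu_Y(A)\bar\mu_Y(B)$ for all measurable $A,B$; $\bar F$ maps each $a\in\alpha$ bijectively onto a union of elements of $\alpha$; any two distinct points of $\bar Y$ have finite separation time $s$ (with respect to $\bar F$ and $\alpha$); for some $\theta\in(0,1)$ and $K$ the density $g=d\bar\mu_Y/d(\bar\mu_Y\circ\bar F)$ has a positive version with $|\log g(y)-\log g(y')|\le K\theta^{s(y,y')}$ for all $y\ne y'$ in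 the same $a\in\alpha$; and $\inf_{a\in\alpha}\bar\mu_Y(\bar Fa)>0$. * (A4) $r\in L^1(Y,\mu_Y)$. Let $\mu_\Delta$ be the restriction of $\mu_Y\times\{\text{counting}\}$ to $\Delta=\{(y,\ell):0\le\ell<r(y)\}$, divided by $\int r\,d\mu_Y$, and let $\mu_M$ be the push-forward of $\mu_\Delta$ to $M$ under $(y,\ell)\mapsto f^\ell y$. Let $v:M\to\mathbb R^d$ be a bounded Hölder function (with some exponent $\eta\in(0,1]$) with $\int v\,d\mu_M=0$, and let $V(y)=\sum_{\ell=0}^{r(y)-1}v(f^\ell y)$ be the induced observable on $Y$. Let $L$ be the transfer operator of $\bar F$, given by $\int L\phi\,\psi\,d\bar\mu_Y=\int\phi\,\psi\circ\bar F\,d\bar\mu_Y$ for $\phi\in L^1(\bar Y)$, $\psi\in L^\infty(\bar Y)$, and acting on $\mathbb R^d$-valued functions coordinatewise. **Theorem.** Suppose that $r\in L^p(Y,\mu_Y)$ for some $1\le p<\infty$. Then there exist $\bar m\in L^p(\bar Y,\bar\mu_Y;\mathbb R^d)$ and $\chi\in L^p(Y,\mu_Y;\mathbb R^d)$ such that *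 (a) $V=\bar m\circ\pi+\chi\circ F-\chi$ $\mu_Y$-almost everywhere, * (b) $\bar m\in\ker L$, i.e. $L\bar m=0$ $\bar\mu_Y$-almost everywhere. -/

import Mathlib

open MeasureTheory Set Filter Topology
open scoped NNReal ENNReal

noncomputable section

/-! ### Gibbs-Markov maps -/

section GibbsMarkov

variable {X : Type*}

/-- The separation time of `x` and `y` under `T` with respect to the partition `P`: the least
`n ≥ 0` such that `T^n x` and `T^n y` lie in distinct elements of `P`
(`⊤` if there is no such `n`). -/
def separationTime (T : X → X) (P : Set (Set X)) (x y : X) : ℕ∞ :=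
  ⨅ (n : ℕ) (_ : ¬ ∃ a ∈ P, T^[n] x ∈ a ∧ T^[n] y ∈ a), (n : ℕ∞)

/-- The symbolic distance `d_θ(x, y) = θ ^ s(x, y)`, with `θ ^ ∞ = 0`. -/
def symbolicDist (T : X → X) (P : Set (Set X)) (θ : ℝ) (x y : X) : ℝ :=
  if separationTime T P x y = ⊤ then 0 else θ ^ (separationTime T P x y).toNat

variable [MeasurableSpace X]

/-- The measure `μ ∘ T`, given by `(μ ∘ T)(A) = ∑_{a ∈ P} μ (T (A ∩ a))`, for a map `T` that is
injective on every element of the countable partition `P`. -/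
def imageMeasure (T : X → X) (μ : Measure X) (P : Set (Set X)) : Measure X :=
  Measure.sum fun a : P => (μ.comap ((a : Set X).domRestrict T)).map Subtype.val

/-- `T` is (strongly) mixing for `μ`. -/
def IsMixing (T : X → X) (μ : Measure X) : Prop :=
  ∀ A B : Set X, MeasurableSet A → MeasurableSet B →
    Tendsto (fun n : ℕ => μ (A ∩ T^[n] ⁻¹' B)) atTop (𝓝 (μ A * μ B))

/-- `T` is a Gibbs-Markov map of the probability space `(X, μ)` with countable measurable
partition `P`. (Used on standard Borel spaces.) -/
structure IsGibbsMarkov (T : X → X) (μ : Measure X) (P : Set (Set X)) : Prop where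
  isProbabilityMeasure : IsProbabilityMeasure μ
  countable : P.Countable
  isPartition : Setoid.IsPartition P
  measurableSet : ∀ a ∈ P, MeasurableSet a
  /-- `T` preserves `μ` and is ergodic. -/
  ergodic : Ergodic T μ
  injOn : ∀ a ∈ P, InjOn T a
  /-- The image of a partition element is a union of partition elements. -/
  markov : ∀ a ∈ P, ∃ Q ⊆ P, T '' a = ⋃₀ Q
  /-- The partition separates orbits. -/
  separates : ∀ x y, x ≠ y → separationTime T P x y ≠ ⊤
  /-- The density `g = dμ / d(μ ∘ T)` has a version whose logarithm is `d_θ`-Lipschitz on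
  partition elements, uniformly over the elements, for some `θ ∈ (0, 1)`. -/
  distortion : ∃ θ : ℝ, 0 < θ ∧ θ < 1 ∧ ∃ g : X → ℝ, Measurable g ∧ (∀ x, 0 < g x) ∧
    μ = (imageMeasure T μ P).withDensity (fun x => ENNReal.ofReal (g x)) ∧
    ∃ K : ℝ, ∀ a ∈ P, ∀ x ∈ a, ∀ y ∈ a,
      |Real.log (g x) - Real.log (g y)| ≤ K * symbolicDist T P θ x y
  /-- Images of partition elements have measure bounded below. -/
  bigImages : ∃ δ : ℝ≥0∞, 0 < δ ∧ ∀ a ∈ P, δ ≤ μ (T '' a)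

/-- The transfer operator of `T` on real functions: for integrable `φ` it is the density with
respect to `μ` of the push-forward under `T` of the signed measure `φ dμ`. -/
def transferOperator (T : X → X) (μ : Measure X) (φ : X → ℝ) : X → ℝ :=
  SignedMeasure.rnDeriv ((μ.withDensityᵥ φ).map T) μ

theorem integrable_transferOperator {X : Type*} [MeasurableSpace X] (T : X → X) (μ : Measure X)
    (φ : X → ℝ) : Integrable (transferOperator T μ φ) μ :=
  SignedMeasure.integrable_rnDeriv _ _

theorem setIntegral_transferOperator {X : Type*} [MeasurableSpace X] {T : X → X} {μ : Measure X}
    [IsFiniteMeasure μ] (hT : MeasurePreserving T μ μ) {φ : X → ℝ} (hφ : Integrable φ μ)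
    {A : Set X} (hA : MeasurableSet A) :
    ∫ x in A, transferOperator T μ φ x ∂μ = ∫ x in T ⁻¹' A, φ x ∂μ := by
  have hac : ((μ.withDensityᵥ φ).map T) ≪ᵥ μ.toENNRealVectorMeasure := by
    refine VectorMeasure.AbsolutelyContinuous.mk fun s hs h0 => ?_
    rw [Measure.toENNRealVectorMeasure_apply_measurable hs] at h0
    rw [VectorMeasure.map_apply _ hT.measurable hs, withDensityᵥ_apply hφ (hT.measurable hs)]
    exact setIntegral_measure_zero _ (by rw [hT.measure_preimage hs.nullMeasurableSet, h0])
  have h := SignedMeasure.withDensityᵥ_rnDeriv_eq _ μ hac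
  rw [← withDensityᵥ_apply (integrable_transferOperator T μ φ) hA, transferOperator, h,
    VectorMeasure.map_apply _ hT.measurable hA, withDensityᵥ_apply hφ (hT.measurable hA)]

/-- The duality that characterizes the transfer operator. -/
theorem integral_transferOperator_mul {X : Type*} [MeasurableSpace X] {T : X → X} {μ : Measure X}
    [IsFiniteMeasure μ] (hT : MeasurePreserving T μ μ) {φ ψ : X → ℝ} (hφ : Integrable φ μ)
    (hψ : MemLp ψ ∞ μ) :
    ∫ x, transferOperator T μ φ x * ψ x ∂μ = ∫ x, φ x * ψ (T x) ∂μ := by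
  have hm := hT.measurable.comap_le
  have hL := integrable_transferOperator T μ φ
  have hLs : StronglyMeasurable (transferOperator T μ φ) :=
    (SignedMeasure.measurable_rnDeriv _ _).stronglyMeasurable
  have hce : (fun x => transferOperator T μ φ (T x)) =ᵐ[μ]
      μ[φ | MeasurableSpace.comap T inferInstance] := by
    refine ae_eq_condExp_of_forall_setIntegral_eq hm hφ
      (fun s _ _ => ((hT.integrable_comp hL.1).2 hL).integrableOn) ?_ ?_
    · rintro s ⟨A, hA, rfl⟩ -
      rw [← setIntegral_transferOperator hT hφ hA]
      have h := setIntegral_map (μ := μ) (f := transferOperator T μ φ) hA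
        hLs.aestronglyMeasurable hT.aemeasurable
      rw [hT.map_eq] at h
      exact h.symm
    · exact (hLs.comp_measurable (comap_measurable T)).aestronglyMeasurable
  -- reduce to a measurable representative of `ψ`
  obtain ⟨ψ', hψ', hψe⟩ := hψ.1
  have hψ'm : MemLp ψ' ∞ μ := hψ.ae_eq hψe
  have hψT : MemLp (fun x => ψ' (T x)) ∞ μ := hψ'm.comp_measurePreserving hT
  have hint : Integrable (φ * fun x => ψ' (T x)) μ := hφ.mul_of_top_left hψT
  have hpull := condExp_mul_of_aestronglyMeasurable_right
    (m := MeasurableSpace.comap T inferInstance)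
    (hψ'.comp_measurable (comap_measurable T)).aestronglyMeasurable hint hφ
  calc ∫ x, transferOperator T μ φ x * ψ x ∂μ
      = ∫ x, transferOperator T μ φ x * ψ' x ∂μ :=
        integral_congr_ae (hψe.mono fun x hx => by simp only [hx])
    _ = ∫ x, transferOperator T μ φ (T x) * ψ' (T x) ∂μ := by
        have h := integral_map (μ := μ) (f := fun x => transferOperator T μ φ x * ψ' x)
          hT.aemeasurable (hLs.mul hψ').aestronglyMeasurable
        rw [hT.map_eq] at h
        exact h
    _ = ∫ x, (μ[φ * fun x => ψ' (T x) | MeasurableSpace.comap T inferInstance]) x ∂μ := by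
        refine integral_congr_ae ?_
        filter_upwards [hce, hpull] with x h1 h2
        exact (h2.trans (by rw [Pi.mul_apply, ← h1]; rfl)).symm
    _ = ∫ x, φ x * ψ' (T x) ∂μ := integral_condExp hm
    _ = ∫ x, φ x * ψ (T x) ∂μ := by
        refine integral_congr_ae ?_
        filter_upwards [hT.quasiMeasurePreserving.ae_eq_comp hψe] with x hx
        simp only [Function.comp_apply] at hx
        rw [hx]

/-- The transfer operator on `ℝ^d`-valued functions, acting on each coordinate. -/
def vectorTransferOperator {d : ℕ} (T : X → X) (μ : Measure X)
    (φ : X → EuclideanSpace ℝ (Fin d)) : X → EuclideanSpace ℝ (Fin d) :=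
  fun x => WithLp.toLp 2 fun i => transferOperator T μ (fun y => φ y i) x

end GibbsMarkov

/-! ### Inducing scheme -/

/-- An inducing scheme with stable leaves on `M`: a map `f : M → M`, a subset `Y`, an inducing time
`r : Y → ℤ⁺` with `f^{r(y)} y ∈ Y`, constant on the elements of a countable partition of `Y`,
a measurable partition of `Y` into stable leaves that refines it, and an unstable leaf. -/
structure InducingScheme (M : Type*) [MeasurableSpace M] where
  f : M → M
  measurable_f : Measurable f
  Y : Set M
  measurableSet_Y : MeasurableSet Y
  r : Y → ℕ
  r_pos : ∀ y, 0 < r y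
  returns : ∀ y : Y, f^[r y] (y : M) ∈ Y
  /-- The countable partition `{Y_j}` of `Y`. -/
  parts : Set (Set Y)
  parts_countable : parts.Countable
  parts_isPartition : Setoid.IsPartition parts
  parts_measurableSet : ∀ a ∈ parts, MeasurableSet a
  r_const : ∀ a ∈ parts, ∀ y ∈ a, ∀ y' ∈ a, r y = r y'
  /-- `y` and `y'` lie in the same stable leaf, `y' ∈ W^s(y)`. -/
  stable : Setoid Y
  /-- The partition into stable leaves is measurable: countably many measurable unions of leaves
  separate the leaves. -/
  stable_measurable : MeasurableSpace.CountablySeparated (Quotient stable)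
  /-- Every `Y_j` is a union of stable leaves. -/
  stable_subset : ∀ a ∈ parts, ∀ y ∈ a, ∀ y', stable y y' → y' ∈ a
  /-- The unstable leaf `W^u`. -/
  unstable : Set Y
  unstable_measurableSet : MeasurableSet unstable
  unstable_existsUnique : ∀ y, ∃! z, z ∈ unstable ∧ stable y z

namespace InducingScheme

section Measurable

variable {M : Type*} [MeasurableSpace M] (S : InducingScheme M)

/-- The induced map `F = f^r : Y → Y`. -/
def F (y : S.Y) : S.Y := ⟨S.f^[S.r y] (y : M), S.returns y⟩

/-- The quotient `Ȳ` of `Y` along stable leaves, with the quotient `σ`-algebra. -/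
abbrev Ybar : Type _ := Quotient S.stable

/-- The projection `π : Y → Ȳ`. -/
def proj (y : S.Y) : S.Ybar := Quotient.mk S.stable y

/-- `F` maps stable leaves into stable leaves: `F (W^s(y)) ⊆ W^s(F y)`. -/
def PreservesLeaves : Prop :=
  ∀ y y', S.stable y y' → S.stable (S.F y) (S.F y')

/-- The quotient map `F̄ : Ȳ → Ȳ`. -/
def Fbar (h : S.PreservesLeaves) : S.Ybar → S.Ybar :=
  Quotient.map S.F fun y y' hy => h y y' hy

/-- The partition `α` of `Ȳ` formed by the images of the `Y_j`. -/
def alpha : Set (Set S.Ybar) := (fun a => S.proj '' a) '' S.parts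

/-- The measure `μ̄_Y = π_* μ_Y`. -/
def muBar (μ : Measure S.Y) : Measure S.Ybar := μ.map S.proj

/-- `F̄` is a mixing Gibbs-Markov map with partition `α` for `μ̄_Y = π_* μ_Y`. -/
def QuotientMixingGibbsMarkov (h : S.PreservesLeaves) (μ : Measure S.Y) : Prop :=
  IsGibbsMarkov (S.Fbar h) (S.muBar μ) S.alpha ∧ IsMixing (S.Fbar h) (S.muBar μ)

/-- The tower measure `μ_Δ = (μ_Y × counting) / ∫ r dμ_Y` on
`Δ = {(y, ℓ) : 0 ≤ ℓ < r(y)}`, seen as a measure on `Y × ℕ`. -/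
def towerMeasure (μ : Measure S.Y) : Measure (S.Y × ℕ) :=
  (∫⁻ y, (S.r y : ℝ≥0∞) ∂μ)⁻¹ • (μ.prod Measure.count).restrict {q | q.2 < S.r q.1}

/-- The measure `μ_M = (π_Δ)_* μ_Δ` on `M`, where `π_Δ(y, ℓ) = f^ℓ y`. -/
def muM (μ : Measure S.Y) : Measure M :=
  (S.towerMeasure μ).map fun q => S.f^[q.2] (q.1 : M)

/-- The induced observable `V(y) = ∑_{ℓ < r(y)} v(f^ℓ y)`. -/
def inducedObservable {E : Type*} [AddCommMonoid E] (v : M → E) (y : S.Y) : E :=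
  ∑ l ∈ Finset.range (S.r y), v (S.f^[l] (y : M))

end Measurable

section Metric

variable {M : Type*} [MeasurableSpace M] [MetricSpace M] (S : InducingScheme M)

/-- Exponential contraction along stable leaves and exponential expansion along the unstable
leaf, at returns to `Y`. -/
def IsUniformlyHyperbolic : Prop :=
  ∃ C γ₀ : ℝ, 1 ≤ C ∧ 0 < γ₀ ∧ γ₀ < 1 ∧
    (∀ y y' : S.Y, S.stable y y' → ∀ j l : ℕ, l ≤ S.r (S.F^[j] y) →
      dist (S.f^[l] (S.F^[j] y : M)) (S.f^[l] (S.F^[j] y' : M)) ≤ C * γ₀ ^ j) ∧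
    (∀ y ∈ S.unstable, ∀ y' ∈ S.unstable, ∀ n : ℕ, separationTime S.F S.parts y y' = n →
      ∀ j l : ℕ, l ≤ S.r (S.F^[j] y) →
      dist (S.f^[l] (S.F^[j] y : M)) (S.f^[l] (S.F^[j] y' : M)) ≤ C * γ₀ ^ ((n : ℤ) - (j : ℤ)))

end Metric

end InducingScheme

/-- `v` is a (bounded) Hölder observable: `|v|_∞ < ∞` and `|v|_η < ∞` for some `η ∈ (0, 1]`. -/
def IsHolderObservable {M E : Type*} [MetricSpace M] [NormedAddCommGroup E] (v : M → E) : Prop :=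
  (∃ B : ℝ, ∀ x, ‖v x‖ ≤ B) ∧ ∃ C η : ℝ≥0, 0 < η ∧ η ≤ 1 ∧ HolderWith C η v

end

/-! ### Separation times and the symbolic metric. -/

section Separation

variable {X : Type*} {T : X → X} {P : Set (Set X)}

/-! Let `ℓ` send a point of the quotient to the point of `W^u` on that leaf. Put `a_j = V ∘ F^j ∘ ℓ
∘ π - V ∘ F^j`. Stable contraction bounds `a_j` by `H γ^j r ∘ F^j`, so `χ₁ = ∑ a_j` converges in
`L^p`. Telescoping gives `V = ∑ U_j ∘ π + χ₁ ∘ F - χ₁`, with `U_0 = V ∘ ℓ` and `U_{j+1} = V ∘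
F^{j+1} ∘ ℓ - V ∘ F^j ∘ ℓ ∘ F̄`.

The series `∑ U_j` is treated term by term, since regularity worsens with `j`. `U_j` has size of
order `θ^j r̄ ∘ F̄^j`, but it is Lipschitz only on cylinders of length `j + 1`, with constant of
order `θ^{-j} r̄ ∘ F̄^j` (`isControlled_leafIncrement`). Applying `L` about `j` times repairs the
regularity, and from then on `L` decays exponentially. Playing smallness against smoothing yields
`‖L^n W_j‖_p ≤ C ν^{n+j}` for `W_j = U_j - ∫ U_j` (`exists_eLpNorm_transferOperator_le`). The double
series `m = ∑_{n,j} (L^n W_j - (L^{n+1} W_j) ∘ F̄)` therefore converges, and `L` kills each term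
(`exists_martingale_coboundary`). The constants `∫ U_j` add up to zero because `V` is centred.

The decay of `L` comes from a coupling on a cone of log-Lipschitz functions. `L` contracts the cone
constant, big images bound `L φ` above by `∫ φ`, and mixing bounds an iterate below on one partition
element `b`. A fixed multiple of `(∫ φ) 1_b` can then be split off without leaving the cone, and the
remaining mass shrinks by a factor `q < 1` (`exists_coupling`). For two functions of equal integral
the split-off parts cancel. This uses the pointwise branch formula `branchSum` with values in `[0,
∞]`, which agrees with `transferOperator` almost everywhere. -/

theorem natCast_le_separationTime {n : ℕ} {x y : X} :
    (n : ℕ∞) ≤ separationTime T P x y ↔ ∀ i < n, ∃ a ∈ P, T^[i] x ∈ a ∧ T^[i] y ∈ a := by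
  simp only [separationTime, le_iInf_iff, Nat.cast_le]
  constructor
  · intro h i hi
    by_contra hne
    exact absurd (h i hne) (by omega)
  · intro h i hne
    by_contra hi
    exact hne (h i (by omega))

theorem separationTime_eq_add_one {x y : X} (h : ∃ a ∈ P, x ∈ a ∧ y ∈ a) :
    separationTime T P x y = separationTime T P (T x) (T y) + 1 := by
  refine ENat.eq_of_forall_natCast_le_iff fun n => ?_
  rcases n with _ | n
  · simp
  rw [natCast_le_separationTime, Nat.cast_add, Nat.cast_one,
    ENat.add_le_add_iff_right ENat.one_ne_top, natCast_le_separationTime]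
  constructor
  · intro H i hi
    simpa only [← Function.iterate_succ_apply] using H (i + 1) (by omega)
  · rintro H (_ | i) hi
    · exact h
    · simpa only [Function.iterate_succ_apply] using H i (by omega)

theorem symbolicDist_nonneg {θ : ℝ} (hθ : 0 ≤ θ) (x y : X) : 0 ≤ symbolicDist T P θ x y := by
  unfold symbolicDist
  split_ifs
  · exact le_rfl
  · positivity

theorem symbolicDist_le_one {θ : ℝ} (hθ : 0 ≤ θ) (hθ1 : θ ≤ 1) (x y : X) :
    symbolicDist T P θ x y ≤ 1 := by
  unfold symbolicDist
  split_ifs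
  · exact zero_le_one
  · exact pow_le_one₀ hθ hθ1

theorem symbolicDist_mono {θ θ' : ℝ} (hθ : 0 ≤ θ) (h : θ ≤ θ') (x y : X) :
    symbolicDist T P θ x y ≤ symbolicDist T P θ' x y := by
  unfold symbolicDist
  split_ifs
  · exact le_rfl
  · exact pow_le_pow_left₀ hθ h _

theorem symbolicDist_of_eq {θ : ℝ} {x y : X} {n : ℕ} (h : separationTime T P x y = n) :
    symbolicDist T P θ x y = θ ^ n := by
  simp [symbolicDist, h]

theorem symbolicDist_eq_mul {θ : ℝ} {x y : X} (h : ∃ a ∈ P, x ∈ a ∧ y ∈ a) :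
    symbolicDist T P θ x y = θ * symbolicDist T P θ (T x) (T y) := by
  have hs := separationTime_eq_add_one (T := T) h
  by_cases ht : separationTime T P (T x) (T y) = ⊤
  · simp [symbolicDist, hs, ht]
  · obtain ⟨n, hn⟩ := ENat.ne_top_iff_exists.1 ht
    rw [symbolicDist_of_eq hn.symm, symbolicDist_of_eq (n := n + 1) (by rw [hs, ← hn]; rfl),
      pow_succ']

end Separation

/-! ### The transfer operator as a sum over inverse branches. -/

section Branches

variable {X : Type*} [MeasurableSpace X]

/-- A Markov map with full distortion control: `g` is the density `dμ / d(μ ∘ T)` and the branches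
are measurable embeddings. -/
structure IsGibbsMap (T : X → X) (μ : Measure X) (P : Set (Set X)) (θ K : ℝ)
    (δ : ℝ≥0∞) (g : X → ℝ≥0∞) : Prop where
  isProbabilityMeasure : IsProbabilityMeasure μ
  countable : P.Countable
  isPartition : Setoid.IsPartition P
  measurableSet : ∀ a ∈ P, MeasurableSet a
  measurePreserving : MeasurePreserving T μ μ
  measurableEmbedding : ∀ a ∈ P, MeasurableEmbedding (a.domRestrict T)
  markov : ∀ a ∈ P, ∃ Q ⊆ P, T '' a = ⋃₀ Q
  theta_pos : 0 < θ
  theta_lt_one : θ < 1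
  nonneg : 0 ≤ K
  measurable_density : Measurable g
  withDensity_eq : μ = (imageMeasure T μ P).withDensity g
  distortion : ∀ a ∈ P, ∀ x ∈ a, ∀ y ∈ a,
    g x ≤ ENNReal.ofReal (Real.exp (K * symbolicDist T P θ x y)) * g y
  delta_pos : 0 < δ
  bigImages : ∀ a ∈ P, δ ≤ μ (T '' a)

/-- Enlarging `θ` enlarges the symbolic distance, so the distortion bound survives. The condition `γ
≤ θ` lets one metric serve both the density and the dynamical contraction. -/
theorem IsGibbsMarkov.exists_isGibbsMap {T : X → X} {μ : Measure X}
    {P : Set (Set X)} (h : IsGibbsMarkov T μ P)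
    (hemb : ∀ a ∈ P, MeasurableEmbedding (a.domRestrict T)) {γ : ℝ} (hγ1 : γ < 1) :
    ∃ θ K δ g, γ ≤ θ ∧ IsGibbsMap T μ P θ K δ g := by
  obtain ⟨θ, hθ0, hθ1, g, hg, hgpos, hμ, K, hK⟩ := h.distortion
  obtain ⟨δ, hδ, hδP⟩ := h.bigImages
  refine ⟨max θ γ, |K|, δ, fun x => ENNReal.ofReal (g x), le_max_right _ _,
    h.isProbabilityMeasure, h.countable, h.isPartition, h.measurableSet,
    h.ergodic.toMeasurePreserving, hemb, h.markov, lt_max_of_lt_left hθ0, max_lt hθ1 hγ1,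
    abs_nonneg K, hg.ennreal_ofReal, hμ, ?_, hδ, hδP⟩
  intro a ha x hx y hy
  rw [← ENNReal.ofReal_mul (Real.exp_pos _).le]
  refine ENNReal.ofReal_le_ofReal ?_
  rw [← Real.log_le_log_iff (hgpos x) (by have := hgpos y; positivity),
    Real.log_mul (Real.exp_pos _).ne' (hgpos y).ne', Real.log_exp]
  have h1 := (le_abs_self _).trans (hK a ha x hx y hy)
  have h2 : K * symbolicDist T P θ x y ≤ |K| * symbolicDist T P (max θ γ) x y :=
    mul_le_mul (le_abs_self K) (symbolicDist_mono hθ0.le (le_max_left _ _) x y)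
      (symbolicDist_nonneg hθ0.le x y) (abs_nonneg K)
  linarith

/-- The contribution of the branch of `T` on `a` to the transfer operator. -/
noncomputable def branchOperator (T : X → X) (g : X → ℝ≥0∞) (a : Set X) (φ : X → ℝ≥0∞) : X → ℝ≥0∞ :=
  Function.extend (a.domRestrict T) (fun y : a => g y * φ y) 0

/-- The transfer operator as a sum over inverse branches, on nonnegative functions. -/
noncomputable def branchSum (T : X → X) (P : Set (Set X)) (g : X → ℝ≥0∞) (φ : X → ℝ≥0∞) (x : X) :
    ℝ≥0∞ :=
  ∑' a : P, branchOperator T g a φ x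

omit [MeasurableSpace X] in
theorem branchOperator_of_notMem {T : X → X} {g : X → ℝ≥0∞} {a : Set X} {φ : X → ℝ≥0∞} {x : X}
    (hx : x ∉ T '' a) : branchOperator T g a φ x = 0 := by
  refine Function.extend_apply' _ _ _ ?_
  rintro ⟨y, rfl⟩
  exact hx ⟨y, y.2, rfl⟩

namespace IsGibbsMap

variable {T : X → X} {μ : Measure X} {P : Set (Set X)} {θ K : ℝ} {δ : ℝ≥0∞} {g : X → ℝ≥0∞}
  (h : IsGibbsMap T μ P θ K δ g)
include h

theorem branchOperator_apply {a : Set X} (ha : a ∈ P) {φ : X → ℝ≥0∞} {x : X} (hx : x ∈ a) :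
    branchOperator T g a φ (T x) = g x * φ x :=
  (h.measurableEmbedding a ha).injective.extend_apply (fun y : a => g y * φ y) 0 ⟨x, hx⟩

theorem branchOperator_mul_comp {a : Set X} (ha : a ∈ P) (φ ψ : X → ℝ≥0∞) (x : X) :
    branchOperator T g a (fun y => φ y * ψ (T y)) x = branchOperator T g a φ x * ψ x := by
  by_cases hx : x ∈ T '' a
  · obtain ⟨y, hy, rfl⟩ := hx
    rw [h.branchOperator_apply ha hy, h.branchOperator_apply ha hy, mul_assoc]
  · rw [branchOperator_of_notMem hx, branchOperator_of_notMem hx, zero_mul]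

theorem branchOperator_add {a : Set X} (ha : a ∈ P) (φ ψ : X → ℝ≥0∞) (x : X) :
    branchOperator T g a (φ + ψ) x = branchOperator T g a φ x + branchOperator T g a ψ x := by
  by_cases hx : x ∈ T '' a
  · obtain ⟨y, hy, rfl⟩ := hx
    simp only [h.branchOperator_apply ha hy, Pi.add_apply, mul_add]
  · simp only [branchOperator_of_notMem hx, zero_add]

theorem branchOperator_mono {a : Set X} (ha : a ∈ P) {φ ψ : X → ℝ≥0∞} (hφ : ∀ x, φ x ≤ ψ x)
    (x : X) : branchOperator T g a φ x ≤ branchOperator T g a ψ x := by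
  by_cases hx : x ∈ T '' a
  · obtain ⟨y, hy, rfl⟩ := hx
    simp only [h.branchOperator_apply ha hy]
    gcongr
    exact hφ y
  · simp only [branchOperator_of_notMem hx, le_refl]

theorem measurable_branchOperator {a : Set X} (ha : a ∈ P) {φ : X → ℝ≥0∞} (hφ : Measurable φ) :
    Measurable (branchOperator T g a φ) :=
  (h.measurableEmbedding a ha).measurable_extend
    ((h.measurable_density.mul hφ).comp measurable_subtype_coe) measurable_zero

theorem eq_of_mem {a b : Set X} (ha : a ∈ P) (hb : b ∈ P) {x : X} (hxa : x ∈ a) (hxb : x ∈ b) :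
    a = b :=
  (h.isPartition.2 x).unique ⟨ha, hxa⟩ ⟨hb, hxb⟩

/-- Change of variables along one branch: on `a`, `μ` has density `g` with respect to the pull-back
of `μ` by the injective branch. -/
theorem lintegral_branchOperator {a : Set X} (ha : a ∈ P) {φ : X → ℝ≥0∞} (hφ : Measurable φ) :
    ∫⁻ x, branchOperator T g a φ x ∂μ = ∫⁻ x in a, φ x ∂μ := by
  have he := h.measurableEmbedding a ha
  have hind : Measurable (a.indicator φ) := hφ.indicator (h.measurableSet a ha)
  have h1 : ∫⁻ x, branchOperator T g a φ x ∂μ =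
      ∫⁻ y : a, g y * φ y ∂(μ.comap (a.domRestrict T)) := by
    have hr : range (a.domRestrict T) = T '' a := by
      ext x; simp
    rw [← setLIntegral_eq_of_support_subset (s := range (a.domRestrict T)), ← he.map_comap,
      he.lintegral_map]
    · exact lintegral_congr fun y => h.branchOperator_apply ha y.2
    · intro x hx
      rw [hr]
      by_contra hne
      exact hx (branchOperator_of_notMem hne)
  rw [h1, ← lintegral_indicator (h.measurableSet a ha)]
  conv_rhs => rw [h.withDensity_eq]
  rw [lintegral_withDensity_eq_lintegral_mul _ h.measurable_density hind, imageMeasure,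
    lintegral_sum_measure, tsum_eq_single (⟨a, ha⟩ : P)]
  · rw [lintegral_map (h.measurable_density.mul hind) measurable_subtype_coe]
    refine lintegral_congr fun y => ?_
    simp
  · intro b hb
    rw [lintegral_map (h.measurable_density.mul hind) measurable_subtype_coe]
    refine (lintegral_congr fun y => ?_).trans lintegral_zero
    have : (y : X) ∉ a := fun hy => hb (Subtype.ext (h.eq_of_mem b.2 ha y.2 hy))
    simp [this]

theorem measurable_branchSum {φ : X → ℝ≥0∞} (hφ : Measurable φ) :
    Measurable (branchSum T P g φ) := by
  have := h.countable.to_subtype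
  exact Measurable.tsum fun a => h.measurable_branchOperator a.2 hφ

theorem lintegral_branchSum {φ : X → ℝ≥0∞} (hφ : Measurable φ) :
    ∫⁻ x, branchSum T P g φ x ∂μ = ∫⁻ x, φ x ∂μ := by
  have := h.countable.to_subtype
  unfold branchSum
  rw [lintegral_tsum fun a => (h.measurable_branchOperator a.2 hφ).aemeasurable]
  simp_rw [fun a : P => h.lintegral_branchOperator a.2 hφ]
  rw [← lintegral_iUnion (fun a : P => h.measurableSet a a.2), ← sUnion_eq_iUnion,
    h.isPartition.sUnion_eq_univ, setLIntegral_univ]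
  intro a b hab
  refine Set.disjoint_left.2 fun x hxa hxb => hab (Subtype.ext (h.eq_of_mem a.2 b.2 hxa hxb))

/-- The pull-out rule. Together with preservation of the integral it gives duality for all iterates.
-/
theorem branchSum_mul_comp (φ ψ : X → ℝ≥0∞) (x : X) :
    branchSum T P g (fun y => φ y * ψ (T y)) x = branchSum T P g φ x * ψ x := by
  unfold branchSum
  rw [← ENNReal.tsum_mul_right]
  exact tsum_congr fun a => h.branchOperator_mul_comp a.2 φ ψ x

theorem branchSum_add (φ ψ : X → ℝ≥0∞) :
    branchSum T P g (φ + ψ) = branchSum T P g φ + branchSum T P g ψ := by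
  ext x
  simp only [branchSum, Pi.add_apply, ← ENNReal.tsum_add]
  exact tsum_congr fun a => h.branchOperator_add a.2 φ ψ x

theorem branchSum_mono {φ ψ : X → ℝ≥0∞} (hφ : ∀ x, φ x ≤ ψ x) (x : X) :
    branchSum T P g φ x ≤ branchSum T P g ψ x :=
  ENNReal.tsum_le_tsum fun a => h.branchOperator_mono a.2 hφ x

theorem branchSum_const_mul (c : ℝ≥0∞) (φ : X → ℝ≥0∞) (x : X) :
    branchSum T P g (fun y => c * φ y) x = c * branchSum T P g φ x := by
  simpa [mul_comm] using h.branchSum_mul_comp φ (fun _ => c) x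

theorem measurable_iterate_branchSum {φ : X → ℝ≥0∞} (hφ : Measurable φ) (n : ℕ) :
    Measurable ((branchSum T P g)^[n] φ) := by
  induction n generalizing φ with
  | zero => exact hφ
  | succ n ih => exact ih (h.measurable_branchSum hφ)

theorem lintegral_iterate_branchSum {φ : X → ℝ≥0∞} (hφ : Measurable φ) (n : ℕ) :
    ∫⁻ x, (branchSum T P g)^[n] φ x ∂μ = ∫⁻ x, φ x ∂μ := by
  induction n generalizing φ with
  | zero => rfl
  | succ n ih =>
    rw [Function.iterate_succ_apply, ih (h.measurable_branchSum hφ), h.lintegral_branchSum hφ]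

theorem iterate_branchSum_add (φ ψ : X → ℝ≥0∞) (n : ℕ) :
    (branchSum T P g)^[n] (φ + ψ) = (branchSum T P g)^[n] φ + (branchSum T P g)^[n] ψ := by
  induction n generalizing φ ψ with
  | zero => rfl
  | succ n ih => simp only [Function.iterate_succ_apply, h.branchSum_add, ih]

theorem iterate_branchSum_mono {φ ψ : X → ℝ≥0∞} (hφ : ∀ x, φ x ≤ ψ x) (n : ℕ) (x : X) :
    (branchSum T P g)^[n] φ x ≤ (branchSum T P g)^[n] ψ x := by
  induction n generalizing φ ψ with
  | zero => exact hφ x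
  | succ n ih => exact ih (h.branchSum_mono hφ)

theorem iterate_branchSum_const_mul (c : ℝ≥0∞) (φ : X → ℝ≥0∞) (n : ℕ) :
    (branchSum T P g)^[n] (fun y => c * φ y) = fun x => c * (branchSum T P g)^[n] φ x := by
  induction n generalizing φ with
  | zero => rfl
  | succ n ih =>
    rw [Function.iterate_succ_apply, funext (h.branchSum_const_mul c φ), ih]
    rfl

theorem iterate_branchSum_mul_comp (φ ψ : X → ℝ≥0∞) (n : ℕ) :
    (branchSum T P g)^[n] (fun y => φ y * ψ (T^[n] y)) =
      fun x => (branchSum T P g)^[n] φ x * ψ x := by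
  induction n generalizing φ with
  | zero => rfl
  | succ n ih =>
    have : branchSum T P g (fun y => φ y * ψ (T^[n + 1] y)) =
        fun x => branchSum T P g φ x * ψ (T^[n] x) :=
      funext (h.branchSum_mul_comp φ (fun x => ψ (T^[n] x)))
    rw [Function.iterate_succ_apply, this, ih]
    rfl

/-- Duality of the transfer operator, on indicator functions. -/
theorem setLIntegral_iterate_branchSum {φ : X → ℝ≥0∞} (hφ : Measurable φ) (n : ℕ) {A : Set X}
    (hA : MeasurableSet A) :
    ∫⁻ x in A, (branchSum T P g)^[n] φ x ∂μ = ∫⁻ x in T^[n] ⁻¹' A, φ x ∂μ := by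
  have hT := h.measurePreserving.measurable.iterate n
  have hi : Measurable (A.indicator (1 : X → ℝ≥0∞)) := measurable_one.indicator hA
  have h1 := h.lintegral_iterate_branchSum
    (φ := fun y => φ y * A.indicator 1 (T^[n] y)) (hφ.mul (hi.comp hT)) n
  rw [h.iterate_branchSum_mul_comp] at h1
  rw [← lintegral_indicator hA, ← lintegral_indicator (hT hA)]
  convert h1 using 2
  · ext x; by_cases hx : x ∈ A <;> simp [hx]
  · ext x; by_cases hx : T^[n] x ∈ A <;> simp [hx]

/-- Invariance of `μ`, read through duality. It holds only almost everywhere, which is why the decay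
estimates do too. -/
theorem iterate_branchSum_const (c : ℝ≥0∞) (n : ℕ) :
    (branchSum T P g)^[n] (fun _ => c) =ᵐ[μ] fun _ => c := by
  have := h.isProbabilityMeasure
  refine ae_eq_of_forall_setLIntegral_eq_of_sigmaFinite
    (h.measurable_iterate_branchSum measurable_const n) measurable_const fun A hA _ => ?_
  rw [h.setLIntegral_iterate_branchSum measurable_const n hA, setLIntegral_const,
    setLIntegral_const, (h.measurePreserving.iterate n).measure_preimage hA.nullMeasurableSet]

end IsGibbsMap

end Branches

/-! ### The cone of log-Lipschitz functions. -/

section Cone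

/-- The logarithm of `φ` is Lipschitz with constant `A` for the symbolic metric, on cylinders of
length `k + 1`. -/
def IsLogLipschitz {X : Type*} (T : X → X) (P : Set (Set X)) (θ : ℝ) (k : ℕ) (A : ℝ)
    (φ : X → ℝ≥0∞) : Prop :=
  ∀ x y, (∀ i ≤ k, ∃ a ∈ P, T^[i] x ∈ a ∧ T^[i] y ∈ a) →
    φ x ≤ ENNReal.ofReal (Real.exp (A * symbolicDist T P θ x y)) * φ y

/-- The gap between `A'` and `A` pays for subtracting `κ`: it gains `w (e^{At} - e^{A't}) ≥ c (A -
A') t`, while the subtraction costs `κ (e^{At} - 1) ≤ κ A t e^A`. -/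
theorem sub_le_exp_mul_sub {A A' t u w c κ : ℝ} (hA' : 0 ≤ A') (hA : A' < A) (ht0 : 0 ≤ t)
    (ht1 : t ≤ 1) (hu : u ≤ Real.exp (A' * t) * w) (hc : 0 ≤ c) (hw : c ≤ w)
    (hκ0 : 0 ≤ κ) (hκ : κ * (A * Real.exp A) ≤ c * (A - A')) :
    u - κ ≤ Real.exp (A * t) * (w - κ) := by
  have h1 : Real.exp (A * t) - 1 ≤ A * t * Real.exp A := by
    have h2 := Real.add_one_le_exp (-(A * t))
    have h3 : Real.exp (A * t) * Real.exp (-(A * t)) = 1 := by rw [← Real.exp_add]; simp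
    have h4 : Real.exp (A * t) ≤ Real.exp A := Real.exp_le_exp.2 (by nlinarith)
    have h5 : 0 ≤ A * t := by nlinarith
    nlinarith [Real.exp_pos (A * t)]
  have h2 : (A - A') * t ≤ Real.exp (A * t) - Real.exp (A' * t) := by
    have h3 := Real.add_one_le_exp ((A - A') * t)
    have h4 : Real.exp (A * t) = Real.exp (A' * t) * Real.exp ((A - A') * t) := by
      rw [← Real.exp_add]; ring_nf
    have h5 : 1 ≤ Real.exp (A' * t) := Real.one_le_exp (by positivity)
    have h6 : 0 ≤ (A - A') * t := mul_nonneg (by linarith) ht0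
    nlinarith
  have h3 : κ * (Real.exp (A * t) - 1) ≤ c * ((A - A') * t) := by
    calc κ * (Real.exp (A * t) - 1) ≤ κ * (A * t * Real.exp A) := by gcongr
      _ = κ * (A * Real.exp A) * t := by ring
      _ ≤ c * (A - A') * t := by gcongr
      _ = _ := by ring
  have h4 : c * ((A - A') * t) ≤ w * (Real.exp (A * t) - Real.exp (A' * t)) :=
    mul_le_mul hw h2 (mul_nonneg (by linarith) ht0) (hc.trans hw)
  nlinarith

variable {X : Type*} [MeasurableSpace X]

namespace IsGibbsMap

variable {T : X → X} {μ : Measure X} {P : Set (Set X)} {θ K : ℝ} {δ : ℝ≥0∞} {g : X → ℝ≥0∞}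
  (h : IsGibbsMap T μ P θ K δ g)
include h

/-- Inverse branches contract the symbolic distance by `θ`, and distortion adds `K`. By the Markov
property two points of one element have the same branches above them, so the sums compare termwise.
At `k = 0` the truncated `k - 1` is harmless: the branch domain supplies the only level required. -/
theorem isLogLipschitz_branchSum {k : ℕ} {A : ℝ} {φ : X → ℝ≥0∞}
    (hφ : IsLogLipschitz T P θ k A φ) :
    IsLogLipschitz T P θ (k - 1) (θ * (K + A)) (branchSum T P g φ) := by
  intro x y hxy
  unfold branchSum
  rw [← ENNReal.tsum_mul_left]
  refine ENNReal.tsum_le_tsum fun ⟨a, ha⟩ => ?_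
  by_cases hx : x ∈ T '' a
  swap
  · rw [branchOperator_of_notMem hx]; exact zero_le
  have hy : y ∈ T '' a := by
    obtain ⟨Q, hQ, hQe⟩ := h.markov a ha
    obtain ⟨b, hb, hxb, hyb⟩ := hxy 0 (Nat.zero_le _)
    rw [hQe] at hx ⊢
    obtain ⟨b', hb', hxb'⟩ := hx
    obtain rfl := h.eq_of_mem (hQ hb') hb hxb' hxb
    exact ⟨b', hb', hyb⟩
  obtain ⟨x, hx, rfl⟩ := hx
  obtain ⟨y, hy, rfl⟩ := hy
  rw [h.branchOperator_apply ha hx, h.branchOperator_apply ha hy]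
  have hd := symbolicDist_eq_mul (T := T) (θ := θ) ⟨a, ha, hx, hy⟩
  have h1 := h.distortion a ha x hx y hy
  have h2 : φ x ≤ _ := hφ x y (by
    rintro (_ | i) hi
    · exact ⟨a, ha, hx, hy⟩
    · simpa only [Function.iterate_succ_apply] using hxy i (by omega))
  refine (mul_le_mul' h1 h2).trans_eq ?_
  rw [mul_mul_mul_comm, ← ENNReal.ofReal_mul (Real.exp_pos _).le, ← Real.exp_add, hd]
  ring_nf

/-- The number `θ K / (1 - θ)` is the fixed point of `A ↦ θ (K + A)`, and the excess over it is
multiplied by `θ` at each step. -/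
theorem isLogLipschitz_iterate_branchSum {j : ℕ} {B : ℝ} {φ : X → ℝ≥0∞}
    (hφ : IsLogLipschitz T P θ j (B * (θ⁻¹) ^ j + θ * K / (1 - θ)) φ) :
    IsLogLipschitz T P θ 0 (B + θ * K / (1 - θ)) ((branchSum T P g)^[j] φ) := by
  have hθ := h.theta_pos
  have hθ1 : 1 - θ ≠ 0 := by have := h.theta_lt_one; linarith
  induction j generalizing φ with
  | zero => simpa using hφ
  | succ j ih =>
    have h1 := h.isLogLipschitz_branchSum hφ
    have e : B * θ⁻¹ ^ j + θ * K / (1 - θ) =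
        θ * (K + (B * θ⁻¹ ^ (j + 1) + θ * K / (1 - θ))) := by
      rw [pow_succ]
      field_simp
      ring
    refine ih ?_
    rw [e]
    exact h1

theorem isLogLipschitz_iterate {A : ℝ} (hA : θ * (K + A) ≤ A) {φ : X → ℝ≥0∞}
    (hφ : IsLogLipschitz T P θ 0 A φ) (n : ℕ) :
    IsLogLipschitz T P θ 0 A ((branchSum T P g)^[n] φ) := by
  induction n generalizing φ with
  | zero => exact hφ
  | succ n ih =>
    refine ih fun x y hxy => (h.isLogLipschitz_branchSum hφ x y hxy).trans ?_
    gcongr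
    exact symbolicDist_nonneg h.theta_pos.le x y

/-- A branch contribution varies by a factor at most `e^{K+A}` on an image of measure at least `δ`,
so each value is controlled by the integral of that contribution. -/
theorem branchSum_le {A : ℝ} (hA : 0 ≤ A) {φ : X → ℝ≥0∞} (hm : Measurable φ)
    (hφ : IsLogLipschitz T P θ 0 A φ) (x : X) :
    branchSum T P g φ x ≤ δ⁻¹ * ENNReal.ofReal (Real.exp (K + A)) * ∫⁻ x, φ x ∂μ := by
  have := h.isProbabilityMeasure
  have hδt : δ ≠ ∞ := by
    obtain ⟨a, ⟨ha, -⟩, -⟩ := h.isPartition.2 x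
    exact ((h.bigImages a ha).trans_lt (measure_lt_top μ _)).ne
  have key : ∀ a ∈ P, branchOperator T g a φ x ≤
      δ⁻¹ * ENNReal.ofReal (Real.exp (K + A)) * ∫⁻ x, branchOperator T g a φ x ∂μ := by
    intro a ha
    by_cases hx : x ∈ T '' a
    swap
    · rw [branchOperator_of_notMem hx]; exact zero_le
    have hb : ∀ z ∈ T '' a, branchOperator T g a φ x ≤
        ENNReal.ofReal (Real.exp (K + A)) * branchOperator T g a φ z := by
      obtain ⟨x, hx, rfl⟩ := hx
      rintro _ ⟨z, hz, rfl⟩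
      rw [h.branchOperator_apply ha hx, h.branchOperator_apply ha hz]
      have h1 := h.distortion a ha x hx z hz
      have h2 : φ x ≤ _ := hφ x z (by
        intro i hi
        obtain rfl : i = 0 := by omega
        exact ⟨a, ha, hx, hz⟩)
      refine (mul_le_mul' h1 h2).trans ?_
      rw [mul_mul_mul_comm, ← ENNReal.ofReal_mul (Real.exp_pos _).le, ← Real.exp_add]
      have h3 := symbolicDist_le_one (T := T) (P := P) h.theta_pos.le h.theta_lt_one.le x z
      gcongr
      · exact mul_le_of_le_one_right h.nonneg h3
      · exact mul_le_of_le_one_right hA h3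
    have hmes : MeasurableSet (T '' a) := by
      have := (h.measurableEmbedding a ha).measurableSet_range
      rwa [Set.range_domRestrict] at this
    have h2 : δ * branchOperator T g a φ x ≤
        ENNReal.ofReal (Real.exp (K + A)) * ∫⁻ x, branchOperator T g a φ x ∂μ := by
      calc δ * branchOperator T g a φ x ≤ branchOperator T g a φ x * μ (T '' a) := by
            rw [mul_comm]; gcongr; exact h.bigImages a ha
        _ = ∫⁻ z in T '' a, branchOperator T g a φ x ∂μ := by rw [setLIntegral_const]
        _ ≤ ∫⁻ z in T '' a, ENNReal.ofReal (Real.exp (K + A)) * branchOperator T g a φ z ∂μ :=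
            setLIntegral_mono' hmes hb
        _ ≤ ∫⁻ z, ENNReal.ofReal (Real.exp (K + A)) * branchOperator T g a φ z ∂μ :=
            setLIntegral_le_lintegral _ _
        _ = _ := lintegral_const_mul _ (h.measurable_branchOperator ha hm)
    calc branchOperator T g a φ x = δ⁻¹ * (δ * branchOperator T g a φ x) := by
          rw [← mul_assoc, ENNReal.inv_mul_cancel h.delta_pos.ne' hδt, one_mul]
      _ ≤ _ := by rw [mul_assoc]; gcongr
  have hc := h.countable.to_subtype
  have hs : ∫⁻ x, φ x ∂μ = ∑' a : P, ∫⁻ x, branchOperator T g a φ x ∂μ := by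
    rw [← h.lintegral_branchSum hm]
    exact lintegral_tsum fun a => (h.measurable_branchOperator a.2 hm).aemeasurable
  rw [hs, ← ENNReal.tsum_mul_left]
  exact ENNReal.tsum_le_tsum fun a => key a a.2

theorem le_exp_mul {A : ℝ} (hA : 0 ≤ A) {φ : X → ℝ≥0∞}
    (hφ : IsLogLipschitz T P θ 0 A φ) {a : Set X} (ha : a ∈ P) {x y : X} (hx : x ∈ a)
    (hy : y ∈ a) : φ x ≤ ENNReal.ofReal (Real.exp A) * φ y := by
  refine (hφ x y ?_).trans ?_
  · intro i hi
    obtain rfl : i = 0 := by omega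
    exact ⟨a, ha, hx, hy⟩
  · gcongr
    exact mul_le_of_le_one_right hA (symbolicDist_le_one h.theta_pos.le h.theta_lt_one.le x y)

theorem mul_measure_le {A : ℝ} (hA : 0 ≤ A) {φ : X → ℝ≥0∞} (hm : Measurable φ)
    (hφ : IsLogLipschitz T P θ 0 A φ) {a : Set X} (ha : a ∈ P) {x : X} (hx : x ∈ a) :
    φ x * μ a ≤ ENNReal.ofReal (Real.exp A) * ∫⁻ y in a, φ y ∂μ := by
  rw [← setLIntegral_const, ← lintegral_const_mul _ hm]
  exact setLIntegral_mono' (h.measurableSet a ha) fun y hy => h.le_exp_mul hA hφ ha hx hy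

theorem setLIntegral_le {A : ℝ} (hA : 0 ≤ A) {φ : X → ℝ≥0∞}
    (hφ : IsLogLipschitz T P θ 0 A φ) {a : Set X} (ha : a ∈ P) {x : X} (hx : x ∈ a) :
    ∫⁻ y in a, φ y ∂μ ≤ ENNReal.ofReal (Real.exp A) * φ x * μ a := by
  rw [← setLIntegral_const]
  exact setLIntegral_mono' (h.measurableSet a ha) fun y hy => h.le_exp_mul hA hφ ha hy hx

theorem isLogLipschitz_indicator {A : ℝ} (hA : 0 ≤ A) {a : Set X} (ha : a ∈ P) :
    IsLogLipschitz T P θ 0 A (a.indicator 1) := by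
  intro x y hxy
  obtain ⟨b, hb, hxb, hyb⟩ := hxy 0 le_rfl
  by_cases hxa : x ∈ a
  · obtain rfl := h.eq_of_mem ha hb hxa hxb
    rw [indicator_of_mem (show x ∈ a from hxb), indicator_of_mem (show y ∈ a from hyb),
      Pi.one_apply, Pi.one_apply, mul_one, ENNReal.one_le_ofReal]
    exact Real.one_le_exp (mul_nonneg hA (symbolicDist_nonneg h.theta_pos.le x y))
  · rw [indicator_of_notMem hxa]; exact zero_le

/-- A finite union of partition elements carries almost all of the mass. -/
theorem exists_finset_measure_compl_lt {ε : ℝ≥0∞} (hε : ε ≠ 0) :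
    ∃ s : Finset P, μ (⋃ a ∈ s, (a : Set X))ᶜ < ε := by
  have := h.isProbabilityMeasure
  have := h.countable.to_subtype
  have hd : Pairwise (Function.onFun Disjoint fun a : P => (a : Set X)) := fun a b hab =>
    Set.disjoint_left.2 fun x hxa hxb => hab (Subtype.ext (h.eq_of_mem a.2 b.2 hxa hxb))
  have hsum : ∑' a : P, μ (a : Set X) = 1 := by
    rw [← measure_iUnion hd (fun a => h.measurableSet a a.2), ← sUnion_eq_iUnion,
      h.isPartition.sUnion_eq_univ, measure_univ]
  have ht := ENNReal.tendsto_tsum_compl_atTop_zero (f := fun a : P => μ (a : Set X))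
    (by rw [hsum]; exact ENNReal.one_ne_top)
  obtain ⟨s, hs⟩ := (ht.eventually (gt_mem_nhds (pos_iff_ne_zero.2 hε))).exists
  refine ⟨s, lt_of_le_of_lt ?_ hs⟩
  refine (measure_mono (t := ⋃ a : {a // a ∉ s}, (a : Set X)) ?_).trans (measure_iUnion_le _)
  intro x hx
  have hxu : x ∈ ⋃₀ P := by rw [h.isPartition.sUnion_eq_univ]; trivial
  obtain ⟨a, ha, hxa⟩ := hxu
  refine mem_iUnion.2 ⟨⟨⟨a, ha⟩, fun has => hx ?_⟩, hxa⟩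
  exact mem_iUnion₂.2 ⟨⟨a, ha⟩, has, hxa⟩

/-- Mixing yields a uniform lower bound for an iterate of the transfer operator on the cone. -/
theorem exists_lintegral_le_iterate (hmix : IsMixing T μ) {A : ℝ} (hA : 0 ≤ A)
    (hAθ : θ * (K + A) ≤ A) :
    ∃ N : ℕ, ∃ b ∈ P, μ b ≠ 0 ∧ ∃ C : ℝ≥0∞, C ≠ ∞ ∧ ∀ φ : X → ℝ≥0∞, Measurable φ →
      IsLogLipschitz T P θ 0 A φ → ∫⁻ x, φ x ∂μ ≠ ∞ → ∀ x ∈ b,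
        ∫⁻ x, φ x ∂μ ≤ C * (branchSum T P g)^[N + 1] φ x := by
  have := h.isProbabilityMeasure
  have := h.countable.to_subtype
  set E := ENNReal.ofReal (Real.exp A) with hE
  obtain ⟨b, hb, hb0⟩ : ∃ b ∈ P, μ b ≠ 0 := by
    by_contra! H
    have h1 : μ (⋃₀ P) = 0 := (measure_sUnion_null_iff h.countable).2 H
    rw [h.isPartition.sUnion_eq_univ, measure_univ] at h1
    exact one_ne_zero h1
  set D := δ⁻¹ * ENNReal.ofReal (Real.exp (K + A)) with hD
  have hDt : D ≠ ∞ :=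
    ENNReal.mul_ne_top (ENNReal.inv_ne_top.2 h.delta_pos.ne') ENNReal.ofReal_ne_top
  -- Since `L φ ≤ D ∫ φ`, a set of measure below `1 / (2D)` carries at most half of the integral of
  -- `L φ`.
  obtain ⟨s, hs⟩ := h.exists_finset_measure_compl_lt (ε := (2 * D)⁻¹)
    (ENNReal.inv_ne_zero.2 (ENNReal.mul_ne_top (by simp) hDt))
  -- Only finitely many elements remain, so mixing provides one time for all of them.
  have hev : ∀ᶠ n : ℕ in atTop, ∀ a ∈ s, μ a * μ b ≤ 2 * μ (a ∩ T^[n] ⁻¹' b) := by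
    rw [Filter.eventually_all_finset]
    intro a _
    by_cases ha0 : μ a = 0
    · simp [ha0]
    have hlt : μ a * μ b / 2 < μ a * μ b :=
      ENNReal.half_lt_self (mul_ne_zero ha0 hb0)
        (ENNReal.mul_ne_top (measure_ne_top _ _) (measure_ne_top _ _))
    filter_upwards [(hmix a b (h.measurableSet a a.2) (h.measurableSet b hb)).eventually
      (lt_mem_nhds hlt)] with n hn
    rw [← ENNReal.mul_div_cancel (a := 2) (b := μ a * μ b) (by simp) (by simp)]
    gcongr
  obtain ⟨N, hN⟩ := hev.exists
  refine ⟨N, b, hb, hb0, 4 * s.card * E ^ 2 / μ b, ?_, fun φ hm hφ hfin x hx => ?_⟩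
  · refine ENNReal.div_ne_top ?_ hb0
    exact ENNReal.mul_ne_top (ENNReal.mul_ne_top (by simp) (by simp))
      (ENNReal.pow_ne_top ENNReal.ofReal_ne_top)
  -- This application of `L`, the extra one in `N + 1`, makes the sup bound available.
  set ψ := branchSum T P g φ with hψ
  have hψm : Measurable ψ := h.measurable_branchSum hm
  have hψc : IsLogLipschitz T P θ 0 A ψ := h.isLogLipschitz_iterate hAθ hφ 1
  have hψi : ∫⁻ x, ψ x ∂μ = ∫⁻ x, φ x ∂μ := h.lintegral_branchSum hm
  have h1 : ∀ a ∈ s, μ b * ∫⁻ y in a, ψ y ∂μ ≤ 2 * E ^ 2 * (branchSum T P g)^[N] ψ x := by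
    intro a ha
    by_cases ha0 : μ a = 0
    · simp [Measure.restrict_eq_zero.2 ha0]
    -- On `a` the function is comparable to its mean, so it dominates a multiple of `1_a`, which is
    -- then pushed forward by `L^N`.
    have e1 : ∀ y, (∫⁻ y in a, ψ y ∂μ) * (a : Set X).indicator 1 y ≤ E * μ a * ψ y := by
      intro y
      by_cases hy : y ∈ (a : Set X)
      · rw [indicator_of_mem hy, Pi.one_apply, mul_one, mul_right_comm]
        exact h.setLIntegral_le hA hψc a.2 hy
      · rw [indicator_of_notMem hy, mul_zero]; exact zero_le
    have e2 := h.iterate_branchSum_mono e1 N x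
    rw [h.iterate_branchSum_const_mul, h.iterate_branchSum_const_mul] at e2
    set ι := (branchSum T P g)^[N] ((a : Set X).indicator 1) with hι
    -- `L^N 1_a` also lies in the cone, so its value at `x ∈ b` controls its integral over `b`,
    -- which by duality is `μ (a ∩ T^{-N} b)`.
    have e3 : μ a * μ b ≤ 2 * (E * ι x) := by
      refine (hN a ha).trans ?_
      gcongr
      have e4 := h.setLIntegral_le hA (h.isLogLipschitz_iterate hAθ
        (h.isLogLipschitz_indicator hA a.2) N) hb hx
      rw [h.setLIntegral_iterate_branchSum
        (measurable_one.indicator (h.measurableSet a a.2)) N (h.measurableSet b hb),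
        lintegral_indicator_one (h.measurableSet a a.2),
        Measure.restrict_apply (h.measurableSet a a.2)] at e4
      refine e4.trans (mul_le_of_le_one_right' prob_le_one)
    have e5 : μ a * (μ b * ∫⁻ y in a, ψ y ∂μ) ≤
        μ a * (2 * E ^ 2 * (branchSum T P g)^[N] ψ x) := by
      calc μ a * (μ b * ∫⁻ y in a, ψ y ∂μ) = (μ a * μ b) * ∫⁻ y in a, ψ y ∂μ := by ring
        _ ≤ 2 * (E * ι x) * ∫⁻ y in a, ψ y ∂μ := by gcongr
        _ = 2 * E * ((∫⁻ y in a, ψ y ∂μ) * ι x) := by ring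
        _ ≤ 2 * E * (E * μ a * (branchSum T P g)^[N] ψ x) := by gcongr
        _ = _ := by ring
    exact (ENNReal.mul_le_mul_iff_right ha0 (measure_ne_top _ _)).1 e5
  have h2 : ∫⁻ x, φ x ∂μ ≤ 2 * ∑ a ∈ s, ∫⁻ y in a, ψ y ∂μ := by
    have e0 : MeasurableSet (⋃ a ∈ s, (a : Set X)) :=
      s.measurableSet_biUnion fun a _ => h.measurableSet a a.2
    have e1 : ∫⁻ y in ⋃ a ∈ s, (a : Set X), ψ y ∂μ ≤ ∑ a ∈ s, ∫⁻ y in a, ψ y ∂μ := by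
      rw [lintegral_biUnion_finset]
      · intro a _ b _ hab
        exact Set.disjoint_left.2 fun x hxa hxb =>
          hab (Subtype.ext (h.eq_of_mem a.2 b.2 hxa hxb))
      · exact fun a _ => h.measurableSet a a.2
    have e2 : ∫⁻ y in (⋃ a ∈ s, (a : Set X))ᶜ, ψ y ∂μ ≤ (∫⁻ x, φ x ∂μ) / 2 := by
      calc ∫⁻ y in (⋃ a ∈ s, (a : Set X))ᶜ, ψ y ∂μ
          ≤ ∫⁻ y in (⋃ a ∈ s, (a : Set X))ᶜ, D * ∫⁻ x, φ x ∂μ ∂μ :=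
            lintegral_mono fun y => h.branchSum_le hA hm hφ y
        _ = D * (∫⁻ x, φ x ∂μ) * μ (⋃ a ∈ s, (a : Set X))ᶜ := setLIntegral_const _ _
        _ ≤ D * (∫⁻ x, φ x ∂μ) * (2 * D)⁻¹ := by gcongr
        _ = (D * D⁻¹) * ((∫⁻ x, φ x ∂μ) / 2) := by
            rw [ENNReal.mul_inv (by simp) (by simp), div_eq_mul_inv]; ring
        _ ≤ 1 * ((∫⁻ x, φ x ∂μ) / 2) := by gcongr; exact ENNReal.mul_inv_le_one D
        _ = _ := one_mul _
    have e3 := lintegral_add_compl ψ e0 (μ := μ)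
    rw [hψi] at e3
    have e4 : (∫⁻ x, φ x ∂μ) / 2 + (∫⁻ x, φ x ∂μ) / 2 ≤
        ∑ a ∈ s, ∫⁻ y in a, ψ y ∂μ + (∫⁻ x, φ x ∂μ) / 2 := by
      rw [ENNReal.add_halves]
      exact e3.symm.le.trans (add_le_add e1 e2)
    have e5 := (ENNReal.add_le_add_iff_right (ENNReal.div_ne_top hfin (by simp))).1 e4
    rw [mul_comm]
    exact (ENNReal.div_le_iff (by simp) (by simp)).1 e5
  have h3 : μ b * ∑ a ∈ s, ∫⁻ y in a, ψ y ∂μ ≤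
      s.card * (2 * E ^ 2 * (branchSum T P g)^[N] ψ x) := by
    rw [Finset.mul_sum, ← nsmul_eq_mul]
    exact Finset.sum_le_card_nsmul _ _ _ h1
  rw [Function.iterate_succ_apply, mul_comm, ← mul_div_assoc,
    ENNReal.le_div_iff_mul_le (Or.inl hb0) (Or.inl (measure_ne_top _ _))]
  calc (∫⁻ x, φ x ∂μ) * μ b ≤ (2 * ∑ a ∈ s, ∫⁻ y in a, ψ y ∂μ) * μ b := by gcongr
    _ = 2 * (μ b * ∑ a ∈ s, ∫⁻ y in a, ψ y ∂μ) := by ring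
    _ ≤ 2 * (s.card * (2 * E ^ 2 * (branchSum T P g)^[N] ψ x)) := by gcongr
    _ = _ := by ring

end IsGibbsMap

end Cone

/-! ### Coupling and exponential decay. -/

section Decay

variable {X : Type*} [MeasurableSpace X]

namespace IsGibbsMap

variable {T : X → X} {μ : Measure X} {P : Set (Set X)} {θ K : ℝ} {δ : ℝ≥0∞} {g : X → ℝ≥0∞}
  (h : IsGibbsMap T μ P θ K δ g)
include h

theorem isLogLipschitz_sub_indicator {A A' : ℝ} (hA' : 0 ≤ A') (hA : A' < A)
    {φ : X → ℝ≥0∞} (hφ : IsLogLipschitz T P θ 0 A' φ) {b : Set X} (hb : b ∈ P)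
    (hfin : ∀ x ∈ b, φ x ≠ ∞) {c κ : ℝ} (hc : 0 ≤ c) (hcφ : ∀ x ∈ b, c ≤ (φ x).toReal)
    (hκ0 : 0 ≤ κ) (hκ : κ * (A * Real.exp A) ≤ c * (A - A')) :
    IsLogLipschitz T P θ 0 A fun x => φ x - b.indicator (fun _ => ENNReal.ofReal κ) x := by
  intro x y hxy
  have hd0 := symbolicDist_nonneg (T := T) (P := P) h.theta_pos.le x y
  have hd1 := symbolicDist_le_one (T := T) (P := P) h.theta_pos.le h.theta_lt_one.le x y
  have h0 := hφ x y hxy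
  obtain ⟨a, ha, hxa, hya⟩ := hxy 0 le_rfl
  by_cases hxb : x ∈ b
  · obtain rfl := h.eq_of_mem ha hb hxa hxb
    have hyb : y ∈ a := hya
    simp only [indicator_of_mem hxb, indicator_of_mem hyb]
    have hu : (φ x).toReal ≤ Real.exp (A' * symbolicDist T P θ x y) * (φ y).toReal := by
      have := ENNReal.toReal_mono (ENNReal.mul_ne_top ENNReal.ofReal_ne_top (hfin y hyb)) h0
      rwa [ENNReal.toReal_mul, ENNReal.toReal_ofReal (Real.exp_pos _).le] at this
    have key := sub_le_exp_mul_sub hA' hA hd0 hd1 hu hc (hcφ y hyb) hκ0 hκ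
    rw [← ENNReal.ofReal_toReal (hfin x hxb), ← ENNReal.ofReal_toReal (hfin y hyb),
      ← ENNReal.ofReal_sub _ hκ0, ← ENNReal.ofReal_sub _ hκ0,
      ← ENNReal.ofReal_mul (Real.exp_pos _).le]
    exact ENNReal.ofReal_le_ofReal key
  · have hyb : y ∉ b := fun hyb => hxb (by
      obtain rfl := h.eq_of_mem ha hb hya hyb
      exact hxa)
    simp only [indicator_of_notMem hxb, indicator_of_notMem hyb, tsub_zero]
    refine h0.trans ?_
    gcongr

/-- One step of the coupling: an iterate of the transfer operator splits off a multiple of a fixed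
function which depends only on the integral. -/
theorem exists_coupling (hmix : IsMixing T μ) {A : ℝ} (hA : 0 ≤ A) (hAθ : θ * (K + A) < A) :
    ∃ N : ℕ, ∃ q : ℝ≥0∞, q < 1 ∧ ∃ f : X → ℝ≥0∞, ∀ φ : X → ℝ≥0∞, Measurable φ →
      IsLogLipschitz T P θ 0 A φ → ∫⁻ x, φ x ∂μ ≠ ∞ →
      ∃ φ' : X → ℝ≥0∞, Measurable φ' ∧ IsLogLipschitz T P θ 0 A φ' ∧
        ∫⁻ x, φ' x ∂μ = q * ∫⁻ x, φ x ∂μ ∧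
        (branchSum T P g)^[N + 1] φ = φ' + fun x => (∫⁻ x, φ x ∂μ) * f x := by
  have := h.isProbabilityMeasure
  obtain ⟨N, b, hb, hb0, C, hC, hlow⟩ := h.exists_lintegral_le_iterate hmix hA hAθ.le
  set A' := θ * (K + A) with hA'
  have hA'0 : 0 ≤ A' := mul_nonneg h.theta_pos.le (add_nonneg h.nonneg hA)
  have hApos : 0 < A := hA'0.trans_lt hAθ
  -- Adding one keeps `c` positive when `C = 0`.
  set c := (C + 1).toReal with hc
  have hc0 : 0 < c := ENNReal.toReal_pos (by simp) (by simp [hC])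
  -- The value for which subtracting `κ I` from a function bounded below by `I / c` raises the cone
  -- constant from `A'` to exactly `A`.
  set κ := (A - A') / (A * Real.exp A * c) with hκ
  have hκ0 : 0 < κ := div_pos (by linarith) (by positivity)
  have hbm := h.measurableSet b hb
  refine ⟨N, 1 - ENNReal.ofReal κ * μ b, ?_, b.indicator fun _ => ENNReal.ofReal κ,
    fun φ hm hφ hfin => ?_⟩
  · refine ENNReal.sub_lt_self (by simp) one_ne_zero (mul_ne_zero ?_ hb0)
    exact (ENNReal.ofReal_pos.2 hκ0).ne'
  set I := ∫⁻ x, φ x ∂μ with hI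
  set ψ := (branchSum T P g)^[N + 1] φ with hψ
  have hψm : Measurable ψ := h.measurable_iterate_branchSum hm _
  have hψi : ∫⁻ x, ψ x ∂μ = I := h.lintegral_iterate_branchSum hm _
  -- The last of the `N + 1` applications improves the constant to `A'`.
  have hψc : IsLogLipschitz T P θ 0 A' ψ := by
    rw [hψ, Function.iterate_succ_apply']
    exact h.isLogLipschitz_branchSum (h.isLogLipschitz_iterate hAθ.le hφ N)
  -- An infinite value would be infinite throughout `b` by comparability, contradicting finite
  -- integral and `μ b ≠ 0`.
  have hψfin : ∀ x ∈ b, ψ x ≠ ∞ := by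
    intro x hx htop
    have h1 := h.mul_measure_le hA'0 hψm hψc hb hx
    rw [htop, ENNReal.top_mul hb0, top_le_iff] at h1
    refine ENNReal.mul_ne_top ENNReal.ofReal_ne_top ?_ h1
    exact ((setLIntegral_le_lintegral _ _).trans_lt (hψi.trans_lt hfin.lt_top)).ne
  have hlow' : ∀ x ∈ b, I.toReal / c ≤ (ψ x).toReal := by
    intro x hx
    rw [div_le_iff₀' hc0, hc, ← ENNReal.toReal_mul]
    refine ENNReal.toReal_mono (ENNReal.mul_ne_top (by simp [hC]) (hψfin x hx)) ?_
    refine (hlow φ hm hφ hfin x hx).trans ?_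
    gcongr
    exact le_self_add
  have hIκ : ∀ x, I * b.indicator (fun _ => ENNReal.ofReal κ) x =
      b.indicator (fun _ => ENNReal.ofReal (I.toReal * κ)) x := by
    intro x
    by_cases hx : x ∈ b
    · rw [indicator_of_mem hx, indicator_of_mem hx, ENNReal.ofReal_mul ENNReal.toReal_nonneg,
        ENNReal.ofReal_toReal hfin]
    · simp [hx]
  have hI0 : 0 ≤ I.toReal := ENNReal.toReal_nonneg
  have hκI : I.toReal * κ * (A * Real.exp A) = I.toReal / c * (A - A') := by
    rw [hκ]; field_simp
  have hle : ∀ x, I * b.indicator (fun _ => ENNReal.ofReal κ) x ≤ ψ x := by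
    intro x
    rw [hIκ]
    by_cases hx : x ∈ b
    · rw [indicator_of_mem hx]
      refine ENNReal.ofReal_le_of_le_toReal ((le_trans ?_ (hlow' x hx)))
      have h1 : κ ≤ 1 / c := by
        rw [hκ, div_le_div_iff₀ (by positivity) hc0, one_mul]
        have h2 : A ≤ A * Real.exp A := le_mul_of_one_le_right hA (Real.one_le_exp hA)
        have h3 : A - A' ≤ A * Real.exp A := by linarith
        gcongr
      rw [div_eq_mul_one_div]
      gcongr
    · simp [hx]
  have hfm : Measurable fun x => I * b.indicator (fun _ => ENNReal.ofReal κ) x :=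
    (measurable_const.indicator hbm).const_mul _
  refine ⟨fun x => ψ x - I * b.indicator (fun _ => ENNReal.ofReal κ) x, hψm.sub hfm, ?_, ?_, ?_⟩
  · simp only [hIκ]
    exact h.isLogLipschitz_sub_indicator hA'0 hAθ hψc hb hψfin (by positivity) hlow'
      (by positivity) hκI.le
  · rw [lintegral_sub hfm _ (Eventually.of_forall hle), hψi,
      lintegral_const_mul _ (measurable_const.indicator hbm), lintegral_indicator_const hbm,
      ENNReal.sub_mul (fun _ _ => hfin), one_mul, mul_comm I]
    rw [lintegral_const_mul _ (measurable_const.indicator hbm), lintegral_indicator_const hbm]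
    exact ENNReal.mul_ne_top hfin
      (ENNReal.mul_ne_top ENNReal.ofReal_ne_top (measure_ne_top _ _))
  · ext x
    exact (tsub_add_cancel_of_le (hle x)).symm

/-- Iterated coupling of two functions in the cone with the same integral. -/
theorem exists_iterate_coupling (hmix : IsMixing T μ) {A : ℝ} (hA : 0 ≤ A)
    (hAθ : θ * (K + A) < A) :
    ∃ N : ℕ, ∃ q : ℝ≥0∞, q < 1 ∧ ∀ k : ℕ, ∀ φ ψ : X → ℝ≥0∞, Measurable φ → Measurable ψ →
      IsLogLipschitz T P θ 0 A φ → IsLogLipschitz T P θ 0 A ψ → ∫⁻ x, φ x ∂μ ≠ ∞ →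
      ∫⁻ x, φ x ∂μ = ∫⁻ x, ψ x ∂μ →
      ∃ φ' ψ' f : X → ℝ≥0∞, Measurable φ' ∧ Measurable ψ' ∧ IsLogLipschitz T P θ 0 A φ' ∧
        IsLogLipschitz T P θ 0 A ψ' ∧ ∫⁻ x, φ' x ∂μ = q ^ k * ∫⁻ x, φ x ∂μ ∧
        ∫⁻ x, ψ' x ∂μ = q ^ k * ∫⁻ x, φ x ∂μ ∧
        (branchSum T P g)^[(N + 1) * k] φ = φ' + f ∧
        (branchSum T P g)^[(N + 1) * k] ψ = ψ' + f := by
  obtain ⟨N, q, hq, f, hf⟩ := h.exists_coupling hmix hA hAθ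
  refine ⟨N, q, hq, fun k => ?_⟩
  induction k with
  | zero =>
    intro φ ψ hφm hψm hφ hψ hfin heq
    exact ⟨φ, ψ, 0, hφm, hψm, hφ, hψ, by simp, by simp [heq], by simp, by simp⟩
  | succ k ih =>
    intro φ ψ hφm hψm hφ hψ hfin heq
    obtain ⟨φ', ψ', f', hφm', hψm', hφ', hψ', hφi, hψi, hφe, hψe⟩ :=
      ih φ ψ hφm hψm hφ hψ hfin heq
    have hfin' : q ^ k * ∫⁻ x, φ x ∂μ ≠ ∞ :=
      ENNReal.mul_ne_top (ENNReal.pow_ne_top hq.ne_top) hfin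
    obtain ⟨φ₂, hφm₂, hφ₂, hφi₂, hφe₂⟩ := hf φ' hφm' hφ' (by rwa [hφi])
    obtain ⟨ψ₂, hψm₂, hψ₂, hψi₂, hψe₂⟩ := hf ψ' hψm' hψ' (by rwa [hψi])
    -- The old common part is transported, and the newly split part is common because the two
    -- remainders have equal integrals.
    refine ⟨φ₂, ψ₂, (fun x => (q ^ k * ∫⁻ x, φ x ∂μ) * f x) + (branchSum T P g)^[N + 1] f',
      hφm₂, hψm₂, hφ₂, hψ₂, ?_, ?_, ?_, ?_⟩
    · rw [hφi₂, hφi, pow_succ', mul_assoc]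
    · rw [hψi₂, hψi, pow_succ', mul_assoc]
    · rw [Nat.mul_succ, add_comm, Function.iterate_add_apply, hφe, h.iterate_branchSum_add, hφe₂,
        hφi, add_assoc]
    · rw [Nat.mul_succ, add_comm, Function.iterate_add_apply, hψe, h.iterate_branchSum_add, hψe₂,
        hψi, add_assoc]

/-- Exponential decay of the transfer operator on the cone. -/
theorem exists_abs_iterate_sub_le (hmix : IsMixing T μ) {A : ℝ} (hA : 0 ≤ A)
    (hAθ : θ * (K + A) < A) :
    ∃ D ρ : ℝ, 0 ≤ D ∧ 0 < ρ ∧ ρ < 1 ∧ ∀ φ : X → ℝ≥0∞, Measurable φ →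
      IsLogLipschitz T P θ 0 A φ → ∫⁻ x, φ x ∂μ ≠ ∞ → ∀ n : ℕ, ∀ᵐ x ∂μ,
        |((branchSum T P g)^[n + 1] φ x).toReal - (∫⁻ x, φ x ∂μ).toReal| ≤
          D * ρ ^ n * (∫⁻ x, φ x ∂μ).toReal := by
  have := h.isProbabilityMeasure
  obtain ⟨N, q, hq, hcoup⟩ := h.exists_iterate_coupling hmix hA hAθ
  set D := δ⁻¹ * ENNReal.ofReal (Real.exp (K + A)) with hD
  have hDt : D ≠ ∞ :=
    ENNReal.mul_ne_top (ENNReal.inv_ne_top.2 h.delta_pos.ne') ENNReal.ofReal_ne_top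
  -- `q` may vanish; the maximum makes the `(N + 1)`-th root positive.
  set s : ℝ := max q.toReal (1 / 2) with hs
  have hs0 : 0 < s := lt_max_of_lt_right (by norm_num)
  have hs1 : s < 1 := by
    refine max_lt ?_ (by norm_num)
    rw [← ENNReal.toReal_one]
    exact (ENNReal.toReal_lt_toReal hq.ne_top ENNReal.one_ne_top).2 hq
  set ρ : ℝ := s ^ ((N + 1 : ℝ)⁻¹) with hρ
  have hρ0 : 0 < ρ := Real.rpow_pos_of_pos hs0 _
  have hρ1 : ρ < 1 := Real.rpow_lt_one hs0.le hs1 (by positivity)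
  have hρN : ρ ^ (N + 1) = s := by
    rw [hρ, ← Real.rpow_natCast, ← Real.rpow_mul hs0.le]
    push_cast
    rw [inv_mul_cancel₀ (by positivity), Real.rpow_one]
  have hpow : ∀ n : ℕ, s ^ (n / (N + 1)) ≤ s⁻¹ * ρ ^ n := by
    intro n
    rw [le_inv_mul_iff₀ hs0, ← pow_succ', ← hρN, ← pow_mul]
    refine pow_le_pow_of_le_one hρ0.le hρ1.le ?_
    have := Nat.lt_mul_div_succ n (Nat.succ_pos N)
    exact this.le
  -- Complete rounds of coupling leave a remainder of integral `q^k I`. At least one application of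
  -- `L` is left over to turn that integral into a sup bound, and the common part is absorbed by the
  -- iterate of `ψ`.
  have hbound : ∀ φ ψ : X → ℝ≥0∞, Measurable φ → Measurable ψ →
      IsLogLipschitz T P θ 0 A φ → IsLogLipschitz T P θ 0 A ψ → ∫⁻ x, φ x ∂μ ≠ ∞ →
      ∫⁻ x, φ x ∂μ = ∫⁻ x, ψ x ∂μ → ∀ n x, (branchSum T P g)^[n + 1] φ x ≤
        D * (q ^ (n / (N + 1)) * ∫⁻ x, φ x ∂μ) + (branchSum T P g)^[n + 1] ψ x := by
    intro φ ψ hφm hψm hφ hψ hfin heq n x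
    obtain ⟨φ', ψ', f, hφm', hψm', hφ', hψ', hφi, hψi, hφe, hψe⟩ :=
      hcoup (n / (N + 1)) φ ψ hφm hψm hφ hψ hfin heq
    have hn : n + 1 = (n % (N + 1) + 1) + (N + 1) * (n / (N + 1)) := by
      have := Nat.mod_add_div n (N + 1)
      omega
    rw [hn, Function.iterate_add_apply, Function.iterate_add_apply _ _ _ ψ, hφe, hψe,
      h.iterate_branchSum_add, h.iterate_branchSum_add, Pi.add_apply, Pi.add_apply]
    refine add_le_add ?_ le_add_self
    rw [Function.iterate_succ_apply', ← hφi,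
      ← h.lintegral_iterate_branchSum hφm' (n % (N + 1))]
    exact h.branchSum_le hA (h.measurable_iterate_branchSum hφm' _)
      (h.isLogLipschitz_iterate hAθ.le hφ' _) x
  refine ⟨D.toReal * s⁻¹, ρ, by positivity, hρ0, hρ1, fun φ hm hφ hfin n => ?_⟩
  set I := ∫⁻ x, φ x ∂μ with hI
  -- The comparison function is the constant `I`, which `L` fixes almost everywhere.
  have hcI : ∫⁻ _ : X, I ∂μ = I := by simp
  have hcc : IsLogLipschitz T P θ 0 A (fun _ => I) := by
    intro x y _
    refine le_mul_of_one_le_left zero_le (ENNReal.one_le_ofReal.2 ?_)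
    exact Real.one_le_exp (mul_nonneg hA (symbolicDist_nonneg h.theta_pos.le x y))
  have hq' : D * (q ^ (n / (N + 1)) * I) ≠ ∞ :=
    ENNReal.mul_ne_top hDt (ENNReal.mul_ne_top (ENNReal.pow_ne_top hq.ne_top) hfin)
  have hqr : (D * (q ^ (n / (N + 1)) * I)).toReal ≤ D.toReal * s⁻¹ * ρ ^ n * I.toReal := by
    rw [ENNReal.toReal_mul (a := D), ENNReal.toReal_mul (b := I), ENNReal.toReal_pow,
      mul_assoc D.toReal, mul_assoc D.toReal]
    gcongr
    exact (pow_le_pow_left₀ ENNReal.toReal_nonneg (le_max_left _ _) _).trans (hpow n)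
  filter_upwards [h.iterate_branchSum_const I (n + 1)] with x hx
  have h1 := hbound φ _ hm measurable_const hφ hcc hfin hcI.symm n x
  have h2 := hbound _ φ measurable_const hm hcc hφ (by rwa [hcI]) hcI n x
  rw [hcI] at h2
  rw [hx] at h1 h2
  have hLt : (branchSum T P g)^[n + 1] φ x ≠ ∞ :=
    (h1.trans_lt (ENNReal.add_lt_top.2 ⟨hq'.lt_top, hfin.lt_top⟩)).ne
  have h3 := ENNReal.toReal_mono (ENNReal.add_ne_top.2 ⟨hq', hfin⟩) h1
  have h4 := ENNReal.toReal_mono (ENNReal.add_ne_top.2 ⟨hq', hLt⟩) h2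
  rw [ENNReal.toReal_add hq' hfin] at h3
  rw [ENNReal.toReal_add hq' hLt] at h4
  rw [abs_le]
  constructor <;> linarith

end IsGibbsMap

end Decay

/-! ### Algebra of the abstract transfer operator. -/

section TransferOperator

variable {X : Type*} [MeasurableSpace X] {T : X → X} {μ : Measure X} [IsFiniteMeasure μ]

theorem transferOperator_ae_eq (hT : MeasurePreserving T μ μ) {φ f : X → ℝ} (hφ : Integrable φ μ)
    (hf : Integrable f μ)
    (h : ∀ A, MeasurableSet A → ∫ x in A, f x ∂μ = ∫ x in T ⁻¹' A, φ x ∂μ) :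
    transferOperator T μ φ =ᵐ[μ] f :=
  (integrable_transferOperator T μ φ).ae_eq_of_forall_setIntegral_eq _ _ hf fun A hA _ => by
    rw [setIntegral_transferOperator hT hφ hA, h A hA]

theorem transferOperator_add (hT : MeasurePreserving T μ μ) {φ ψ : X → ℝ} (hφ : Integrable φ μ)
    (hψ : Integrable ψ μ) : transferOperator T μ (fun x => φ x + ψ x) =ᵐ[μ]
      fun x => transferOperator T μ φ x + transferOperator T μ ψ x := by
  have h1 := integrable_transferOperator T μ φ
  have h2 := integrable_transferOperator T μ ψ
  refine transferOperator_ae_eq hT (hφ.add hψ) (h1.add h2) fun A hA => ?_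
  rw [integral_add h1.integrableOn h2.integrableOn,
    integral_add hφ.integrableOn hψ.integrableOn, setIntegral_transferOperator hT hφ hA,
    setIntegral_transferOperator hT hψ hA]

theorem transferOperator_const_mul (hT : MeasurePreserving T μ μ) (c : ℝ) {φ : X → ℝ}
    (hφ : Integrable φ μ) : transferOperator T μ (fun x => c * φ x) =ᵐ[μ]
      fun x => c * transferOperator T μ φ x := by
  have h1 := integrable_transferOperator T μ φ
  refine transferOperator_ae_eq hT (hφ.const_mul c) (h1.const_mul c) fun A hA => ?_
  rw [integral_const_mul, integral_const_mul, setIntegral_transferOperator hT hφ hA]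

theorem transferOperator_const (hT : MeasurePreserving T μ μ) (c : ℝ) :
    transferOperator T μ (fun _ => c) =ᵐ[μ] fun _ => c := by
  refine transferOperator_ae_eq hT (integrable_const c) (integrable_const c) fun A hA => ?_
  rw [setIntegral_const, setIntegral_const, measureReal_def, measureReal_def,
    hT.measure_preimage hA.nullMeasurableSet]

theorem transferOperator_mono (hT : MeasurePreserving T μ μ) {φ ψ : X → ℝ} (hφ : Integrable φ μ)
    (hψ : Integrable ψ μ) (h : ∀ᵐ x ∂μ, φ x ≤ ψ x) :
    ∀ᵐ x ∂μ, transferOperator T μ φ x ≤ transferOperator T μ ψ x := by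
  refine ae_le_of_forall_setIntegral_le (integrable_transferOperator _ _ _)
    (integrable_transferOperator _ _ _) fun A hA _ => ?_
  rw [setIntegral_transferOperator hT hφ hA, setIntegral_transferOperator hT hψ hA]
  exact setIntegral_mono_ae hφ.integrableOn hψ.integrableOn h

theorem abs_transferOperator_le (hT : MeasurePreserving T μ μ) {φ ψ : X → ℝ} (hφ : Integrable φ μ)
    (hψ : Integrable ψ μ) (h : ∀ᵐ x ∂μ, |φ x| ≤ ψ x) :
    ∀ᵐ x ∂μ, |transferOperator T μ φ x| ≤ transferOperator T μ ψ x := by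
  have h1 := transferOperator_mono hT hφ hψ (h.mono fun x hx => (le_abs_self _).trans hx)
  have h2 := transferOperator_mono hT (hφ.const_mul (-1)) hψ
    (h.mono fun x hx => by simpa using (neg_le_abs _).trans hx)
  filter_upwards [h1, h2, transferOperator_const_mul hT (-1) hφ] with x e1 e2 e3
  rw [e3] at e2
  exact abs_le.2 ⟨by linarith, e1⟩

theorem transferOperator_comp {S : X → X} (hT : MeasurePreserving T μ μ)
    (hS : MeasurePreserving S μ μ) {φ : X → ℝ} (hφ : Integrable φ μ) :
    transferOperator (S ∘ T) μ (fun x => φ (T x)) =ᵐ[μ] transferOperator S μ φ := by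
  have hi : Integrable (fun x => φ (T x)) μ := (hT.integrable_comp hφ.1).2 hφ
  refine transferOperator_ae_eq (hS.comp hT) hi (integrable_transferOperator _ _ _) fun A hA => ?_
  rw [setIntegral_transferOperator hS hφ hA, preimage_comp]
  have := setIntegral_map (μ := μ) (f := φ) (hS.measurable hA)
    (by rw [hT.map_eq]; exact hφ.1) hT.aemeasurable
  rwa [hT.map_eq] at this

theorem transferOperator_comp_self (hT : MeasurePreserving T μ μ) {φ : X → ℝ}
    (hφ : Integrable φ μ) : transferOperator T μ (fun x => φ (T x)) =ᵐ[μ] φ := by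
  refine (transferOperator_comp hT (MeasurePreserving.id μ) hφ).trans ?_
  exact transferOperator_ae_eq (MeasurePreserving.id μ) hφ hφ fun A _ => rfl

omit [IsFiniteMeasure μ] in
-- Both operators satisfy the same duality on indicators. This carries the pointwise cone estimates
-- over to the operator of the theorem.
theorem IsGibbsMap.transferOperator_iterate_toReal {P : Set (Set X)} {θ K : ℝ} {δ : ℝ≥0∞}
    {g : X → ℝ≥0∞} (h : IsGibbsMap T μ P θ K δ g) {φ : X → ℝ≥0∞} (hm : Measurable φ)
    (hfin : ∫⁻ x, φ x ∂μ ≠ ∞) (n : ℕ) :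
    transferOperator T^[n] μ (fun x => (φ x).toReal) =ᵐ[μ]
      fun x => ((branchSum T P g)^[n] φ x).toReal := by
  have := h.isProbabilityMeasure
  have hLm := h.measurable_iterate_branchSum hm n
  have hLfin : ∫⁻ x, (branchSum T P g)^[n] φ x ∂μ ≠ ∞ := by
    rwa [h.lintegral_iterate_branchSum hm]
  refine transferOperator_ae_eq (h.measurePreserving.iterate n)
    (integrable_toReal_of_lintegral_ne_top hm.aemeasurable hfin)
    (integrable_toReal_of_lintegral_ne_top hLm.aemeasurable hLfin) fun A hA => ?_
  rw [integral_toReal hLm.aemeasurable (ae_restrict_of_ae (ae_lt_top hLm hLfin)),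
    integral_toReal hm.aemeasurable (ae_restrict_of_ae (ae_lt_top hm hfin)),
    h.setLIntegral_iterate_branchSum hm n hA]

end TransferOperator

/-! ### Decay for functions whose regularity worsens with `j`. -/

section Estimate

variable {X : Type*} [MeasurableSpace X] {T : X → X} {μ : Measure X} {P : Set (Set X)}
  {θ K : ℝ} {δ : ℝ≥0∞} {g : X → ℝ≥0∞}

/-- A function which is controlled, together with its symbolic Lipschitz seminorm on cylinders of
length `j + 1`, by a weight at time `j`. -/
structure IsControlled (T : X → X) (P : Set (Set X)) (θ : ℝ) (B : ℝ) (r : X → ℝ) (j : ℕ)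
    (U : X → ℝ) : Prop where
  measurable : Measurable U
  abs_le : ∀ x, |U x| ≤ B * θ ^ j * r (T^[j] x)
  abs_sub_le : ∀ x y, (∀ i ≤ j, ∃ a ∈ P, T^[i] x ∈ a ∧ T^[i] y ∈ a) →
    |U x - U y| ≤ B * r (T^[j] y) * (θ⁻¹ ^ j * symbolicDist T P θ x y)

namespace IsGibbsMap

variable (h : IsGibbsMap T μ P θ K δ g)
include h

theorem isLogLipschitz_ofReal_comp_iterate {r : X → ℝ}
    (hrP : ∀ a ∈ P, ∀ x ∈ a, ∀ y ∈ a, r x = r y) {A : ℝ} (hA : 0 ≤ A) (j : ℕ) (B : ℝ) :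
    IsLogLipschitz T P θ j A fun x => ENNReal.ofReal (B * r (T^[j] x)) := by
  intro x y hxy
  obtain ⟨a, ha, hx, hy⟩ := hxy j le_rfl
  simp only [hrP a ha _ hx _ hy]
  refine le_mul_of_one_le_left zero_le (ENNReal.one_le_ofReal.2 ?_)
  exact Real.one_le_exp (mul_nonneg hA (symbolicDist_nonneg h.theta_pos.le x y))

/-- After the shift the function is at least `B r ∘ T^j`, which is constant on cylinders of length
`j + 1` and is the very factor in the Lipschitz bound. The additive modulus thus becomes a
multiplicative one of order `θ^{-j}`. -/
theorem isLogLipschitz_ofReal_add {r : X → ℝ} (hr0 : ∀ x, 0 ≤ r x)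
    (hrP : ∀ a ∈ P, ∀ x ∈ a, ∀ y ∈ a, r x = r y) {A B : ℝ} (hA : 0 ≤ A) (hB : 0 ≤ B)
    {j : ℕ} {U : X → ℝ} (hU : IsControlled T P θ B r j U) :
    IsLogLipschitz T P θ j (1 * θ⁻¹ ^ j + A)
      fun x => ENNReal.ofReal (U x + 2 * B * r (T^[j] x)) := by
  intro x y hxy
  have hθ := h.theta_pos
  set d := symbolicDist T P θ x y with hd
  have hd0 : 0 ≤ d := symbolicDist_nonneg hθ.le x y
  obtain ⟨a, ha, hxa, hya⟩ := hxy j le_rfl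
  have h1 := (le_abs_self _).trans (hU.abs_sub_le x y hxy)
  have h2 := (neg_le_abs _).trans (hU.abs_le y)
  have h3 : θ ^ j ≤ 1 := pow_le_one₀ hθ.le h.theta_lt_one.le
  have h4 : B * θ ^ j * r (T^[j] y) ≤ B * r (T^[j] y) := by
    rw [mul_right_comm]
    exact mul_le_of_le_one_right (mul_nonneg hB (hr0 _)) h3
  have h5 : 0 ≤ B * r (T^[j] y) := mul_nonneg hB (hr0 _)
  simp only [hrP a ha _ hxa _ hya]
  rw [← ENNReal.ofReal_mul (Real.exp_pos _).le]
  refine ENNReal.ofReal_le_ofReal ?_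
  have h6 : θ⁻¹ ^ j * d + 1 ≤ Real.exp ((1 * θ⁻¹ ^ j + A) * d) := by
    refine (Real.add_one_le_exp _).trans (Real.exp_le_exp.2 ?_)
    nlinarith [mul_nonneg hA hd0]
  have h7 : 0 ≤ U y + 2 * B * r (T^[j] y) := by linarith
  have h8 : 0 ≤ θ⁻¹ ^ j * d := by positivity
  calc U x + 2 * B * r (T^[j] y)
      ≤ (U y + 2 * B * r (T^[j] y)) + B * r (T^[j] y) * (θ⁻¹ ^ j * d) := by linarith
    _ ≤ (U y + 2 * B * r (T^[j] y)) + (U y + 2 * B * r (T^[j] y)) * (θ⁻¹ ^ j * d) := by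
        gcongr; linarith
    _ = (θ⁻¹ ^ j * d + 1) * (U y + 2 * B * r (T^[j] y)) := by ring
    _ ≤ _ := by gcongr

theorem integral_comp_iterate {r : X → ℝ} (hri : Integrable r μ) (j : ℕ) :
    Integrable (fun x => r (T^[j] x)) μ ∧ ∫ x, r (T^[j] x) ∂μ = ∫ x, r x ∂μ := by
  have hTj := h.measurePreserving.iterate j
  refine ⟨(hTj.integrable_comp hri.1).2 hri, ?_⟩
  have := integral_map (μ := μ) (f := r) hTj.aemeasurable (by rw [hTj.map_eq]; exact hri.1)
  rw [hTj.map_eq] at this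
  exact this.symm

theorem integrable_of_isControlled {r : X → ℝ} (hri : Integrable r μ) {B : ℝ} {j : ℕ} {U : X → ℝ}
    (hU : IsControlled T P θ B r j U) : Integrable U μ :=
  ((h.integral_comp_iterate hri j).1.const_mul (B * θ ^ j)).mono'
    hU.measurable.aestronglyMeasurable (Eventually.of_forall hU.abs_le)

theorem abs_integral_le_of_isControlled {r : X → ℝ} (hri : Integrable r μ) {B : ℝ}
    {j : ℕ} {U : X → ℝ} (hU : IsControlled T P θ B r j U) :
    |∫ x, U x ∂μ| ≤ B * θ ^ j * ∫ x, r x ∂μ := by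
  obtain ⟨h1, h2⟩ := h.integral_comp_iterate hri j
  calc |∫ x, U x ∂μ| ≤ ∫ x, |U x| ∂μ := abs_integral_le_integral_abs
    _ ≤ ∫ x, B * θ ^ j * r (T^[j] x) ∂μ :=
        integral_mono (h.integrable_of_isControlled hri hU).abs (h1.const_mul _) hU.abs_le
    _ = _ := by rw [integral_const_mul, h2]

/-- Only the size of `U` enters. This serves the range where `n` is too small for smoothing to help.
-/
theorem abs_transferOperator_le_of_isControlled {r : X → ℝ} (hri : Integrable r μ) {B : ℝ}
    {j : ℕ} {U : X → ℝ} (hU : IsControlled T P θ B r j U) (n : ℕ) :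
    ∀ᵐ x ∂μ, |transferOperator T^[n] μ (fun x => U x - ∫ y, U y ∂μ) x| ≤
      B * θ ^ j * (transferOperator T^[n] μ (fun x => r (T^[j] x)) x + ∫ y, r y ∂μ) := by
  have := h.isProbabilityMeasure
  have hTn := h.measurePreserving.iterate n
  have hrj := (h.integral_comp_iterate hri j).1
  have hUi := h.integrable_of_isControlled hri hU
  have hcle := h.abs_integral_le_of_isControlled hri hU
  generalize ∫ x, U x ∂μ = c at hcle ⊢
  generalize ∫ x, r x ∂μ = R at hcle ⊢
  have hUc : ∀ x, |U x - c| ≤ B * θ ^ j * (r (T^[j] x) + R) := fun x => by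
    have := abs_sub (U x) c
    have := hU.abs_le x
    linarith
  have h1 := abs_transferOperator_le hTn (hUi.sub (integrable_const c))
    ((hrj.add (integrable_const R)).const_mul (B * θ ^ j)) (Eventually.of_forall hUc)
  have h2 := transferOperator_const_mul hTn (B * θ ^ j) (hrj.add (integrable_const R))
  have h3 := transferOperator_add hTn hrj (integrable_const R)
  filter_upwards [h1, h2, h3, transferOperator_const hTn R] with x e1 e2 e3 e4
  refine e1.trans_eq ?_
  rw [e4] at e3
  rw [← e3]
  exact e2

/-- The first `j` iterates undo the composition with `T^j`. At least one more remains, and it makes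
`r` bounded although `r` itself is only integrable. -/
theorem abs_transferOperator_add_one_le {r : X → ℝ} (hr0 : ∀ x, 0 ≤ r x)
    (hrP : ∀ a ∈ P, ∀ x ∈ a, ∀ y ∈ a, r x = r y) (hrm : Measurable r) (hri : Integrable r μ)
    {A D ρ : ℝ} (hA : 0 ≤ A) (hD : 0 ≤ D) (hρ0 : 0 ≤ ρ) (hρ1 : ρ ≤ 1)
    (hdec : ∀ φ : X → ℝ≥0∞, Measurable φ →
      IsLogLipschitz T P θ 0 A φ → ∫⁻ x, φ x ∂μ ≠ ∞ → ∀ n : ℕ, ∀ᵐ x ∂μ,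
        |((branchSum T P g)^[n + 1] φ x).toReal - (∫⁻ x, φ x ∂μ).toReal| ≤
          D * ρ ^ n * (∫⁻ x, φ x ∂μ).toReal) (j m : ℕ) :
    ∀ᵐ x ∂μ, transferOperator T^[j + m + 1] μ (fun x => r (T^[j] x)) x ≤
      (D + 1) * ∫ y, r y ∂μ := by
  have := h.isProbabilityMeasure
  have h1 : transferOperator T^[j + m + 1] μ (fun x => r (T^[j] x)) =ᵐ[μ]
      transferOperator T^[m + 1] μ r := by
    have := transferOperator_comp (h.measurePreserving.iterate j)
      (h.measurePreserving.iterate (m + 1)) hri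
    rwa [← Function.iterate_add, show m + 1 + j = j + m + 1 by ring] at this
  have hR0 : 0 ≤ ∫ x, r x ∂μ := integral_nonneg hr0
  have hrl : ∫⁻ x, ENNReal.ofReal (r x) ∂μ = ENNReal.ofReal (∫ x, r x ∂μ) :=
    (ofReal_integral_eq_lintegral_ofReal hri (Eventually.of_forall hr0)).symm
  have hrf : ∫⁻ x, ENNReal.ofReal (r x) ∂μ ≠ ∞ := by rw [hrl]; exact ENNReal.ofReal_ne_top
  have h2 := h.transferOperator_iterate_toReal hrm.ennreal_ofReal hrf (m + 1)
  have hcone : IsLogLipschitz T P θ 0 A fun x => ENNReal.ofReal (r x) := by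
    simpa using h.isLogLipschitz_ofReal_comp_iterate hrP hA 0 1
  have h3 := hdec _ hrm.ennreal_ofReal hcone hrf m
  filter_upwards [h1, h2, h3] with x e2 e3 e4
  simp only [ENNReal.toReal_ofReal (hr0 _)] at e3
  rw [hrl, ENNReal.toReal_ofReal hR0] at e4
  rw [e2, e3]
  have e5 := (le_abs_self _).trans e4
  have e6 : D * ρ ^ m * (∫ y, r y ∂μ) ≤ D * ∫ y, r y ∂μ := by
    have : ρ ^ m ≤ 1 := pow_le_one₀ hρ0 hρ1
    gcongr
    exact mul_le_of_le_one_right hD this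
  linarith

/-- Write `U = (U + 2B r ∘ T^j) - 2B r ∘ T^j`. After `j` iterates both terms lie in a cone
independent of `j`; their integrals are at most `3BR` and `2BR`, whence the factor `5`. -/
theorem abs_transferOperator_le_pow {r : X → ℝ} (hr0 : ∀ x, 0 ≤ r x)
    (hrP : ∀ a ∈ P, ∀ x ∈ a, ∀ y ∈ a, r x = r y) (hrm : Measurable r) (hri : Integrable r μ)
    {D ρ : ℝ} (hD : 0 ≤ D) (hρ0 : 0 ≤ ρ)
    (hdec : ∀ φ : X → ℝ≥0∞, Measurable φ →
      IsLogLipschitz T P θ 0 (1 + θ * K / (1 - θ)) φ → ∫⁻ x, φ x ∂μ ≠ ∞ → ∀ n : ℕ, ∀ᵐ x ∂μ,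
        |((branchSum T P g)^[n + 1] φ x).toReal - (∫⁻ x, φ x ∂μ).toReal| ≤
          D * ρ ^ n * (∫⁻ x, φ x ∂μ).toReal)
    {B : ℝ} (hB : 0 ≤ B) {j : ℕ} {U : X → ℝ} (hU : IsControlled T P θ B r j U) (m : ℕ) :
    ∀ᵐ x ∂μ, |transferOperator T^[j + m + 1] μ (fun x => U x - ∫ y, U y ∂μ) x| ≤
      D * (5 * B * ∫ y, r y ∂μ) * ρ ^ m := by
  have := h.isProbabilityMeasure
  have hθ := h.theta_pos
  have hTn := h.measurePreserving.iterate (j + m + 1)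
  obtain ⟨hrj, hrjR⟩ := h.integral_comp_iterate hri j
  have hUi := h.integrable_of_isControlled hri hU
  have hcle := h.abs_integral_le_of_isControlled hri hU
  have hR0 : 0 ≤ ∫ y, r y ∂μ := integral_nonneg hr0
  have hj1 : θ ^ j ≤ 1 := pow_le_one₀ hθ.le h.theta_lt_one.le
  have hA₁ : 0 ≤ θ * K / (1 - θ) :=
    div_nonneg (mul_nonneg hθ.le h.nonneg) (by linarith [h.theta_lt_one])
  have hrjm : Measurable fun x => r (T^[j] x) :=
    hrm.comp (h.measurePreserving.iterate j).measurable
  have hΦ0 : ∀ x, 0 ≤ U x + 2 * B * r (T^[j] x) := fun x => by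
    have h2 := (neg_le_abs _).trans (hU.abs_le x)
    have h5 : 0 ≤ B * r (T^[j] x) := mul_nonneg hB (hr0 _)
    have h4 : B * θ ^ j * r (T^[j] x) ≤ B * r (T^[j] x) := by
      rw [mul_right_comm]
      exact mul_le_of_le_one_right h5 hj1
    linarith
  have hΨ0 : ∀ x, 0 ≤ 2 * B * r (T^[j] x) := fun x => by have := hr0 (T^[j] x); positivity
  have hΨint : Integrable (fun x => 2 * B * r (T^[j] x)) μ := hrj.const_mul _
  have hΦint : Integrable (fun x => U x + 2 * B * r (T^[j] x)) μ := hUi.add hΨint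
  have hΨl : ∫⁻ x, ENNReal.ofReal (2 * B * r (T^[j] x)) ∂μ =
      ENNReal.ofReal (2 * B * ∫ y, r y ∂μ) := by
    rw [← hrjR, ← integral_const_mul]
    exact (ofReal_integral_eq_lintegral_ofReal hΨint (Eventually.of_forall hΨ0)).symm
  have hΦl : ∫⁻ x, ENNReal.ofReal (U x + 2 * B * r (T^[j] x)) ∂μ =
      ENNReal.ofReal ((∫ x, U x ∂μ) + 2 * B * ∫ y, r y ∂μ) := by
    rw [← hrjR, ← integral_const_mul, ← integral_add hUi hΨint]
    exact (ofReal_integral_eq_lintegral_ofReal hΦint (Eventually.of_forall hΦ0)).symm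
  have hΦc0 : 0 ≤ (∫ x, U x ∂μ) + 2 * B * ∫ y, r y ∂μ := by
    have := integral_nonneg (μ := μ) (f := fun x => U x + 2 * B * r (T^[j] x)) hΦ0
    rwa [integral_add hUi hΨint, integral_const_mul, hrjR] at this
  have hΦm : Measurable fun x => ENNReal.ofReal (U x + 2 * B * r (T^[j] x)) :=
    (hU.measurable.add (hrjm.const_mul _)).ennreal_ofReal
  have hΨm : Measurable fun x => ENNReal.ofReal (2 * B * r (T^[j] x)) :=
    (hrjm.const_mul _).ennreal_ofReal
  have hΦc := h.isLogLipschitz_iterate_branchSum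
    (h.isLogLipschitz_ofReal_add hr0 hrP hA₁ hB hU)
  have hΨc := h.isLogLipschitz_iterate_branchSum (B := 1) (j := j)
    (h.isLogLipschitz_ofReal_comp_iterate hrP (by positivity) j (2 * B))
  have e1 := hdec _ (h.measurable_iterate_branchSum hΦm j) hΦc
    (by rw [h.lintegral_iterate_branchSum hΦm, hΦl]; exact ENNReal.ofReal_ne_top) m
  have e2 := hdec _ (h.measurable_iterate_branchSum hΨm j) hΨc
    (by rw [h.lintegral_iterate_branchSum hΨm, hΨl]; exact ENNReal.ofReal_ne_top) m
  have e3 := h.transferOperator_iterate_toReal hΦm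
    (by rw [hΦl]; exact ENNReal.ofReal_ne_top) (j + m + 1)
  have e4 := h.transferOperator_iterate_toReal hΨm
    (by rw [hΨl]; exact ENNReal.ofReal_ne_top) (j + m + 1)
  simp only [ENNReal.toReal_ofReal (hΦ0 _)] at e3
  simp only [ENNReal.toReal_ofReal (hΨ0 _)] at e4
  rw [h.lintegral_iterate_branchSum hΦm, hΦl] at e1
  rw [h.lintegral_iterate_branchSum hΨm, hΨl] at e2
  have hcB : (∫ x, U x ∂μ) ≤ B * ∫ y, r y ∂μ := by
    refine (le_abs_self _).trans (hcle.trans ?_)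
    gcongr
    exact mul_le_of_le_one_right hB hj1
  generalize (∫ x, U x ∂μ) = c at *
  generalize (∫ y, r y ∂μ) = R at *
  have e5 := transferOperator_add hTn hUi hΨint
  have e6 := transferOperator_add hTn hUi (integrable_const (-c))
  have e7 := transferOperator_const hTn (-c)
  filter_upwards [e1, e2, e3, e4, e5, e6, e7] with x f1 f2 f3 f4 f5 f6 f7
  have hjm : m + 1 + j = j + m + 1 := by ring
  rw [← Function.iterate_add_apply, hjm, ← f3, ENNReal.toReal_ofReal hΦc0, f5] at f1
  rw [← Function.iterate_add_apply, hjm, ← f4, ENNReal.toReal_ofReal (by positivity)] at f2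
  simp only [sub_eq_add_neg]
  rw [f6, f7]
  have f9 : D * ρ ^ m * (c + 2 * B * R) ≤ D * ρ ^ m * (3 * B * R) := by
    gcongr; linarith
  rw [abs_le] at f1 f2 ⊢
  constructor <;> linarith [f1.1, f1.2, f2.1, f2.2]

/-- Summable decay of the transfer operator on centred controlled functions. -/
theorem exists_eLpNorm_transferOperator_le (hmix : IsMixing T μ) {r : X → ℝ} (hr0 : ∀ x, 0 ≤ r x)
    (hrP : ∀ a ∈ P, ∀ x ∈ a, ∀ y ∈ a, r x = r y) (hrm : Measurable r) {p : ℝ≥0∞}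
    (hp : 1 ≤ p) (hr : MemLp r p μ) {B : ℝ} (hB : 0 ≤ B) :
    ∃ C ν : ℝ, 0 ≤ C ∧ 0 < ν ∧ ν < 1 ∧ ∀ j U, IsControlled T P θ B r j U → ∀ n,
      eLpNorm (transferOperator T^[n] μ fun x => U x - ∫ y, U y ∂μ) p μ ≤
        ENNReal.ofReal (C * (ν ^ n * ν ^ j)) := by
  have := h.isProbabilityMeasure
  have hθ := h.theta_pos
  have hθ1 := h.theta_lt_one
  have hri : Integrable r μ := hr.integrable hp
  have hA₁0 : 0 ≤ θ * K / (1 - θ) := div_nonneg (mul_nonneg hθ.le h.nonneg) (by linarith)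
  have hAθ : θ * (K + (1 + θ * K / (1 - θ))) < 1 + θ * K / (1 - θ) := by
    have : θ * (K + θ * K / (1 - θ)) = θ * K / (1 - θ) := by
      field_simp [show 1 - θ ≠ 0 by linarith]; ring
    nlinarith
  obtain ⟨D, ρ, hD, hρ0, hρ1, hdec⟩ := h.exists_abs_iterate_sub_le hmix (by linarith) hAθ
  have hR0 : 0 ≤ ∫ x, r x ∂μ := integral_nonneg hr0
  have hQm : MemLp (fun x => r x + ∫ y, r y ∂μ) p μ := hr.add (memLp_const _)
  obtain ⟨Q, hQ0, hQ⟩ : ∃ Q : ℝ, 0 ≤ Q ∧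
      eLpNorm (fun x => r x + ∫ y, r y ∂μ) p μ = ENNReal.ofReal Q :=
    ⟨_, ENNReal.toReal_nonneg, (ENNReal.ofReal_toReal hQm.eLpNorm_ne_top).symm⟩
  -- A fourth root suffices: in each range below, `n + j` exceeds four times the available exponent
  -- of `θ` or `ρ` by at most one, and `ν⁻¹` absorbs that unit.
  obtain ⟨ν, hν0, hν1, hθν, hρν⟩ : ∃ ν : ℝ, 0 < ν ∧ ν < 1 ∧
      (∀ k l : ℕ, l ≤ 4 * k → θ ^ k ≤ ν ^ l) ∧ ∀ k l : ℕ, l ≤ 4 * k → ρ ^ k ≤ ν ^ l := by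
    have hτ0 : 0 < max θ ρ := lt_max_of_lt_left hθ
    have hν0 : 0 < max θ ρ ^ ((4 : ℝ)⁻¹) := Real.rpow_pos_of_pos hτ0 _
    have hν1 : max θ ρ ^ ((4 : ℝ)⁻¹) < 1 :=
      Real.rpow_lt_one hτ0.le (max_lt hθ1 hρ1) (by norm_num)
    have hν4 : (max θ ρ ^ ((4 : ℝ)⁻¹)) ^ 4 = max θ ρ := by
      rw [← Real.rpow_natCast, ← Real.rpow_mul hτ0.le]; norm_num
    have key : ∀ k l : ℕ, l ≤ 4 * k → max θ ρ ^ k ≤ (max θ ρ ^ ((4 : ℝ)⁻¹)) ^ l := by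
      intro k l hl
      conv_lhs => rw [← hν4, ← pow_mul]
      exact pow_le_pow_of_le_one hν0.le hν1.le hl
    exact ⟨_, hν0, hν1,
      fun k l hl => (pow_le_pow_left₀ hθ.le (le_max_left _ _) _).trans (key k l hl),
      fun k l hl => (pow_le_pow_left₀ hρ0.le (le_max_right _ _) _).trans (key k l hl)⟩
  have hν' : ∀ l : ℕ, ν⁻¹ * ν ^ (l + 1) = ν ^ l := fun l => by
    rw [pow_succ', inv_mul_cancel_left₀ hν0.ne']
  have hdom := fun j U hU n => h.abs_transferOperator_le_of_isControlled hri (B := B) (j := j)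
    (U := U) hU n
  have hone := h.abs_transferOperator_add_one_le hr0 hrP hrm hri (by linarith) hD hρ0.le
    hρ1.le hdec
  have hpow := fun j U hU m => h.abs_transferOperator_le_pow hr0 hrP hrm hri hD hρ0.le hdec hB
    (j := j) (U := U) hU m
  generalize (∫ y, r y ∂μ) = R at *
  clear hdec
  have hX : 0 ≤ B * Q := by positivity
  have hY : 0 ≤ B * ((D + 1) * R + R) * ν⁻¹ := by positivity
  have hZ : 0 ≤ D * (5 * B * R) * ν⁻¹ := by positivity
  refine ⟨B * Q + B * ((D + 1) * R + R) * ν⁻¹ + D * (5 * B * R) * ν⁻¹, ν, by positivity, hν0, hν1,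
    fun j U hU n => ?_⟩
  rw [← pow_add]
  -- For `n ≤ j`, `L^n (r ∘ T^j) = r ∘ T^{j-n}` is bounded only in `L^p`; the smallness `θ^j` is
  -- enough.
  rcases le_or_gt n j with hnj | hnj
  · obtain ⟨k, rfl⟩ := Nat.exists_eq_add_of_le' hnj
    have hTk := h.measurePreserving.iterate k
    have h1 : transferOperator T^[n] μ (fun x => r (T^[k + n] x)) =ᵐ[μ] fun x => r (T^[k] x) := by
      have := transferOperator_comp_self (h.measurePreserving.iterate n)
        (h.integral_comp_iterate hri k).1
      simpa only [Function.iterate_add_apply] using this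
    have h2 : ∀ᵐ x ∂μ, ‖transferOperator T^[n] μ (fun x => U x - ∫ y, U y ∂μ) x‖ ≤
        B * θ ^ (k + n) * ‖r (T^[k] x) + R‖ := by
      filter_upwards [hdom _ U hU n, h1] with x e1 e2
      rw [e2] at e1
      rwa [Real.norm_eq_abs, Real.norm_of_nonneg (add_nonneg (hr0 _) hR0)]
    refine (eLpNorm_le_mul_eLpNorm_of_ae_le_mul h2 p).trans ?_
    have h4 : eLpNorm (fun x => r (T^[k] x) + R) p μ = ENNReal.ofReal Q := by
      rw [← hQ]
      exact eLpNorm_comp_measurePreserving (f := T^[k]) (g := fun x => r x + R) hQm.1 hTk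
    rw [h4, ← ENNReal.ofReal_mul (by positivity)]
    refine ENNReal.ofReal_le_ofReal ?_
    calc B * θ ^ (k + n) * Q = B * Q * θ ^ (k + n) := by ring
      _ ≤ B * Q * ν ^ (n + (k + n)) := by
        gcongr
        exact hθν _ _ (by omega)
      _ ≤ _ := by gcongr; linarith
  · obtain ⟨m, rfl⟩ := Nat.exists_eq_add_of_lt hnj
    refine (eLpNorm_le_of_ae_bound
      (C := (B * Q + B * ((D + 1) * R + R) * ν⁻¹ + D * (5 * B * R) * ν⁻¹) *
        ν ^ (j + m + 1 + j)) ?_).trans_eq (by simp)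
    -- With `n = j + m + 1`, the factor `θ^j` still wins when `m ≤ j`; otherwise the decay `ρ^m`
    -- takes over.
    rcases le_total m j with hmj | hjm
    · filter_upwards [hdom j U hU (j + m + 1), hone j m] with x e1 e2
      rw [Real.norm_eq_abs]
      calc _ ≤ _ := e1
        _ ≤ B * θ ^ j * ((D + 1) * R + R) := by gcongr
        _ = B * ((D + 1) * R + R) * θ ^ j := by ring
        _ ≤ B * ((D + 1) * R + R) * (ν⁻¹ * ν ^ (j + m + j + 1)) := by
            rw [hν']
            gcongr
            exact hθν _ _ (by omega)
        _ = B * ((D + 1) * R + R) * ν⁻¹ * ν ^ (j + m + 1 + j) := by ring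
        _ ≤ _ := by gcongr; linarith
    · filter_upwards [hpow j U hU m] with x e1
      rw [Real.norm_eq_abs]
      calc _ ≤ _ := e1
        _ ≤ D * (5 * B * R) * (ν⁻¹ * ν ^ (j + m + j + 1)) := by
            rw [hν']
            gcongr
            exact hρν _ _ (by omega)
        _ = D * (5 * B * R) * ν⁻¹ * ν ^ (j + m + 1 + j) := by ring
        _ ≤ _ := by gcongr; linarith

end IsGibbsMap

end Estimate

/-! ### Martingale-coboundary decomposition from double summability. -/

section Coboundary

variable {X : Type*} [MeasurableSpace X] {μ : Measure X} [IsProbabilityMeasure μ]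

theorem norm_setIntegral_le_norm_Lp {p : ℝ≥0∞} [Fact (1 ≤ p)] (f : Lp ℝ p μ) (s : Set X) :
    ‖∫ x in s, f x ∂μ‖ ≤ ‖f‖ := by
  have hp : (1 : ℝ≥0∞) ≤ p := Fact.out
  have hi : Integrable f μ := (Lp.memLp f).integrable hp
  calc ‖∫ x in s, f x ∂μ‖ ≤ ∫ x in s, ‖f x‖ ∂μ := norm_integral_le_integral_norm _
    _ ≤ ∫ x, ‖f x‖ ∂μ :=
        setIntegral_le_integral hi.norm (Eventually.of_forall fun x => norm_nonneg _)
    _ = (eLpNorm f 1 μ).toReal := by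
        rw [integral_norm_eq_lintegral_enorm hi.1, eLpNorm_one_eq_lintegral_enorm]
    _ ≤ (eLpNorm f p μ).toReal :=
        ENNReal.toReal_mono (Lp.eLpNorm_ne_top f) (eLpNorm_le_eLpNorm_of_exponent_le hp hi.1)
    _ = ‖f‖ := (Lp.norm_def f).symm

/-- Integration over a set is continuous on `L^p` of a probability space. Thus `L m = 0` can be
tested termwise, without continuity of `L`. -/
theorem setIntegral_eq_zero_of_hasSum {ι : Type*} {p : ℝ≥0∞} [Fact (1 ≤ p)] {f : ι → Lp ℝ p μ}
    {m : Lp ℝ p μ} (hf : HasSum f m) {s : Set X} (h : ∀ i, ∫ x in s, f i x ∂μ = 0) :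
    ∫ x in s, m x ∂μ = 0 := by
  have hi : ∀ f : Lp ℝ p μ, IntegrableOn f s μ := fun f =>
    ((Lp.memLp f).integrable Fact.out).integrableOn
  let Λ : Lp ℝ p μ →L[ℝ] ℝ := LinearMap.mkContinuous
    { toFun := fun f => ∫ x in s, f x ∂μ
      map_add' := fun f g => by
        rw [← integral_add (hi f) (hi g)]
        exact integral_congr_ae (ae_restrict_of_ae (Lp.coeFn_add f g))
      map_smul' := fun c f => by
        rw [RingHom.id_apply, smul_eq_mul, ← integral_const_mul]
        exact integral_congr_ae (ae_restrict_of_ae (Lp.coeFn_smul c f)) }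
    1 fun f => by simpa using norm_setIntegral_le_norm_Lp f s
  have h1 := hf.mapL Λ
  have h2 : (fun i => Λ (f i)) = fun _ => 0 := funext h
  rw [h2] at h1
  exact h1.unique hasSum_zero

variable {T : X → X}

/-- A martingale-coboundary decomposition for sums of functions with summable decay under the
transfer operator. -/
theorem exists_martingale_coboundary (hT : MeasurePreserving T μ μ) {p : ℝ≥0∞} [Fact (1 ≤ p)]
    {W : ℕ → X → ℝ} (hW : ∀ j, MemLp (W j) p μ) {C ν : ℝ} (hC : 0 ≤ C) (hν0 : 0 < ν) (hν1 : ν < 1)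
    (hb : ∀ n j, eLpNorm (transferOperator T^[n] μ (W j)) p μ ≤
      ENNReal.ofReal (C * (ν ^ n * ν ^ j))) :
    ∃ m χ : Lp ℝ p μ, HasSum (fun j => (hW j).toLp (W j))
        (m + Lp.compMeasurePreserving T hT χ - χ) ∧ transferOperator T μ m =ᵐ[μ] 0 := by
  have hp : (1 : ℝ≥0∞) ≤ p := Fact.out
  have hWi : ∀ j, Integrable (W j) μ := fun j => (hW j).integrable hp
  have hmem : ∀ n j, MemLp (transferOperator T^[n] μ (W j)) p μ := fun n j =>
    ⟨(integrable_transferOperator _ _ _).1, (hb n j).trans_lt ENNReal.ofReal_lt_top⟩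
  let E : ℕ × ℕ → Lp ℝ p μ := fun q => (hmem q.1 q.2).toLp _
  have hE0 : ∀ j, E (0, j) = (hW j).toLp (W j) := fun j =>
    MemLp.toLp_congr _ _ (transferOperator_ae_eq (MeasurePreserving.id μ) (hWi j) (hWi j)
      fun A _ => rfl)
  have hnorm : ∀ q, ‖E q‖ ≤ C * (ν ^ q.1 * ν ^ q.2) := fun q => by
    rw [Lp.norm_toLp]
    exact ENNReal.toReal_le_of_le_ofReal (by positivity) (hb q.1 q.2)
  have hgeo := summable_geometric_of_lt_one hν0.le hν1
  have hgeo2 : Summable fun q : ℕ × ℕ => C * (ν ^ q.1 * ν ^ q.2) :=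
    (hgeo.mul_of_nonneg hgeo (fun n => by positivity) (fun n => by positivity)).mul_left C
  have hsum : Summable E := Summable.of_norm_bounded hgeo2 hnorm
  have hinj : Function.Injective fun q : ℕ × ℕ => (q.1 + 1, q.2) := fun a b hab => by
    simp only [Prod.mk.injEq, add_left_inj] at hab
    exact Prod.ext hab.1 hab.2
  have hsum' : Summable fun q : ℕ × ℕ => E (q.1 + 1, q.2) := hsum.comp_injective hinj
  set χ := ∑' q : ℕ × ℕ, E (q.1 + 1, q.2) with hχ
  let κ : Lp ℝ p μ →L[ℝ] Lp ℝ p μ :=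
    (Lp.compMeasurePreservingₗᵢ ℝ T hT).toContinuousLinearMap
  have hκ : ∀ f, κ f = Lp.compMeasurePreserving T hT f := fun f => rfl
  -- Each term is `L^n W_j - (L^{n+1} W_j) ∘ T`, killed by `L` because `L (f ∘ T) = f`.
  have hm : HasSum (fun q : ℕ × ℕ => E q - κ (E (q.1 + 1, q.2))) ((∑' q, E q) - κ χ) :=
    hsum.hasSum.sub (hsum'.hasSum.mapL κ)
  refine ⟨(∑' q, E q) - κ χ, χ, ?_, ?_⟩
  · have h0 : Summable fun j => E (0, j) := hsum.prod_factor 0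
    -- The terms with `n = 0` are the `W_j` themselves; those with `n ≥ 1` make up `χ`.
    have h1 : ∑' q, E q = ∑' j, E (0, j) + χ := by
      rw [hsum.tsum_prod, hsum.prod.tsum_eq_zero_add, hχ, hsum'.tsum_prod]
    rw [h1, hκ, add_sub_assoc, add_sub_assoc, add_assoc]
    simp only [hE0] at h0 ⊢
    convert h0.hasSum using 1
    abel
  · refine transferOperator_ae_eq hT ((Lp.memLp _).integrable hp) (integrable_zero _ _ _)
      fun A hA => ?_
    -- Over `T⁻¹ A` both parts of the term `(n, j)` integrate to the integral of `W_j` over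
    -- `T^{-(n+1)} A`.
    have h1 := setIntegral_eq_zero_of_hasSum hm (s := T ⁻¹' A) fun q => ?_
    · rw [h1]; simp
    have hTn := hT.iterate q.1
    have hTn1 := hT.iterate (q.1 + 1)
    have e1 : ∫ x in T ⁻¹' A, E q x ∂μ = ∫ x in T^[q.1] ⁻¹' (T ⁻¹' A), W q.2 x ∂μ := by
      rw [← setIntegral_transferOperator hTn (hWi q.2) (hT.measurable hA)]
      exact integral_congr_ae (ae_restrict_of_ae (hmem q.1 q.2).coeFn_toLp)
    have e2 : ∫ x in T ⁻¹' A, κ (E (q.1 + 1, q.2)) x ∂μ =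
        ∫ x in T^[q.1 + 1] ⁻¹' A, W q.2 x ∂μ := by
      rw [← setIntegral_transferOperator hTn1 (hWi q.2) hA, hκ,
        integral_congr_ae (ae_restrict_of_ae (Lp.coeFn_compMeasurePreserving _ hT))]
      have e3 := setIntegral_map (μ := μ) (f := E (q.1 + 1, q.2)) hA
        (by rw [hT.map_eq]; exact (Lp.memLp _).1) hT.aemeasurable
      rw [hT.map_eq] at e3
      refine e3.symm.trans ?_
      exact integral_congr_ae (ae_restrict_of_ae (hmem (q.1 + 1) q.2).coeFn_toLp)
    have hi : ∀ f : Lp ℝ p μ, IntegrableOn f (T ⁻¹' A) μ := fun f =>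
      ((Lp.memLp f).integrable hp).integrableOn
    rw [integral_congr_ae (ae_restrict_of_ae (Lp.coeFn_sub _ _))]
    simp only [Pi.sub_apply]
    rw [integral_sub (hi _) (hi _), e1, e2, Function.iterate_succ', preimage_comp, sub_self]

end Coboundary

/-! ### The quotient system, its section through `W^u`, and the mean of `V`. -/

namespace InducingScheme

section Measurable

variable {M : Type*} [MeasurableSpace M] (S : InducingScheme M)

theorem r_eq_of_stable {y y' : S.Y} (h : S.stable y y') : S.r y = S.r y' := by
  obtain ⟨a, ⟨ha, hy⟩, -⟩ := S.parts_isPartition.2 y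
  exact S.r_const a ha y hy y' (S.stable_subset a ha y hy y' h)

theorem measurable_r : Measurable S.r := by
  refine measurable_to_countable fun y₀ => ?_
  have : S.r ⁻¹' {S.r y₀} = ⋃₀ {a ∈ S.parts | ∃ y ∈ a, S.r y = S.r y₀} := by
    ext y
    constructor
    · intro hy
      obtain ⟨a, ⟨ha, hya⟩, -⟩ := S.parts_isPartition.2 y
      exact ⟨a, ⟨ha, y, hya, hy⟩, hya⟩
    · rintro ⟨a, ⟨ha, y', hy', he⟩, hya⟩
      exact (S.r_const a ha y hya y' hy').trans he
  rw [this]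
  exact MeasurableSet.sUnion (S.parts_countable.mono fun a ha => ha.1)
    fun a ha => S.parts_measurableSet a ha.1

theorem measurable_iterate_f (n : ℕ) : Measurable fun y : S.Y => S.f^[n] (y : M) :=
  (S.measurable_f.iterate n).comp measurable_subtype_coe

theorem measurable_inducedObservable {v : M → ℝ} (hv : Measurable v) :
    Measurable (S.inducedObservable v) := by
  have : Measurable fun q : ℕ × S.Y => ∑ l ∈ Finset.range q.1, v (S.f^[l] (q.2 : M)) :=
    measurable_from_prod_countable_right fun n =>
      Finset.measurable_fun_sum (Finset.range n) fun l _ => hv.comp (S.measurable_iterate_f l)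
  exact this.comp (S.measurable_r.prodMk measurable_id)

theorem measurable_proj : Measurable S.proj := measurable_quotient_mk''

theorem proj_eq_iff {y y' : S.Y} : S.proj y = S.proj y' ↔ S.stable y y' :=
  Quotient.eq (r := S.stable)

/-- The section of the projection with values in the unstable leaf. -/
noncomputable def leafPoint (x : S.Ybar) : S.Y := (S.unstable_existsUnique x.out).choose

theorem leafPoint_mem (x : S.Ybar) : S.leafPoint x ∈ S.unstable :=
  (S.unstable_existsUnique x.out).choose_spec.1.1

theorem proj_leafPoint (x : S.Ybar) : S.proj (S.leafPoint x) = x := by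
  have h := (S.unstable_existsUnique x.out).choose_spec.1.2
  exact (S.proj_eq_iff.2 h).symm.trans (Quotient.out_eq x)

theorem stable_leafPoint_proj (y : S.Y) : S.stable (S.leafPoint (S.proj y)) y :=
  S.proj_eq_iff.1 (S.proj_leafPoint _)

theorem leafPoint_eq_of_mem {y : S.Y} (hy : y ∈ S.unstable) : S.leafPoint (S.proj y) = y :=
  (S.unstable_existsUnique y).unique
    ⟨S.leafPoint_mem _, Setoid.symm' _ (S.stable_leafPoint_proj y)⟩ ⟨hy, Setoid.refl' _ y⟩

theorem injOn_proj : InjOn S.proj S.unstable := fun y hy y' hy' h => by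
  rw [← S.leafPoint_eq_of_mem hy, h, S.leafPoint_eq_of_mem hy']

theorem exists_alpha_iff {y y' : S.Y} :
    (∃ a ∈ S.alpha, S.proj y ∈ a ∧ S.proj y' ∈ a) ↔ ∃ a ∈ S.parts, y ∈ a ∧ y' ∈ a := by
  constructor
  · rintro ⟨_, ⟨a, ha, rfl⟩, ⟨z, hz, hzy⟩, ⟨z', hz', hzy'⟩⟩
    exact ⟨a, ha, S.stable_subset a ha z hz y (S.proj_eq_iff.1 hzy),
      S.stable_subset a ha z' hz' y' (S.proj_eq_iff.1 hzy')⟩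
  · rintro ⟨a, ha, hy, hy'⟩
    exact ⟨_, ⟨a, ha, rfl⟩, ⟨y, hy, rfl⟩, ⟨y', hy', rfl⟩⟩

variable {S}

theorem Fbar_proj (h : S.PreservesLeaves) (y : S.Y) : S.Fbar h (S.proj y) = S.proj (S.F y) := rfl

theorem iterate_Fbar_proj (h : S.PreservesLeaves) (n : ℕ) (y : S.Y) :
    (S.Fbar h)^[n] (S.proj y) = S.proj (S.F^[n] y) := by
  induction n generalizing y with
  | zero => rfl
  | succ n ih => rw [Function.iterate_succ_apply, Fbar_proj, ih, Function.iterate_succ_apply]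

theorem stable_iterate (h : S.PreservesLeaves) {y y' : S.Y} (hy : S.stable y y') (n : ℕ) :
    S.stable (S.F^[n] y) (S.F^[n] y') := by
  rw [← S.proj_eq_iff, ← iterate_Fbar_proj h, ← iterate_Fbar_proj h, S.proj_eq_iff.2 hy]

theorem separationTime_proj (h : S.PreservesLeaves) (y y' : S.Y) :
    separationTime (S.Fbar h) S.alpha (S.proj y) (S.proj y') =
      separationTime S.F S.parts y y' := by
  refine ENat.eq_of_forall_natCast_le_iff fun n => ?_
  simp only [natCast_le_separationTime, iterate_Fbar_proj, exists_alpha_iff]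

end Measurable

section Borel

variable {M : Type*} [MetricSpace M] [PolishSpace M] [MeasurableSpace M] [BorelSpace M]
  (S : InducingScheme M)

/-- A preimage under the section is the image under `π` of a measurable part of `W^u`, where `π` is
injective. The Lusin–Souslin theorem needs only a countably separated target, so the quotient need
not be known to be standard Borel. -/
theorem measurable_leafPoint : Measurable S.leafPoint := by
  have := S.measurableSet_Y.standardBorel
  have := S.stable_measurable
  intro s hs
  have h := (S.unstable_measurableSet.inter hs).image_of_measurable_injOn S.measurable_proj
    (S.injOn_proj.mono inter_subset_left)
  convert h using 1
  ext x
  constructor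
  · intro hx
    exact ⟨S.leafPoint x, ⟨S.leafPoint_mem x, hx⟩, S.proj_leafPoint x⟩
  · rintro ⟨y, ⟨hy, hys⟩, rfl⟩
    rwa [mem_preimage, S.leafPoint_eq_of_mem hy]

/-- Images are lifted to `W^u` so that Lusin–Souslin applies with the standard Borel space `Y` as
source. -/
theorem measurableEmbedding_restrict_Fbar (h : S.PreservesLeaves) {a : Set S.Ybar}
    (ha : MeasurableSet a) (hT : Measurable (S.Fbar h)) (hinj : InjOn (S.Fbar h) a) :
    MeasurableEmbedding (a.domRestrict (S.Fbar h)) := by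
  have := S.measurableSet_Y.standardBorel
  have := S.stable_measurable
  refine ⟨injOn_iff_injective.1 hinj, hT.comp measurable_subtype_coe, fun s hs => ?_⟩
  have hs' : MeasurableSet (S.proj ⁻¹' (Subtype.val '' s)) :=
    S.measurable_proj ((MeasurableEmbedding.subtype_coe ha).measurableSet_image.2 hs)
  have himg := (S.unstable_measurableSet.inter hs').image_of_measurable_injOn
    (hT.comp S.measurable_proj) (fun y hy y' hy' he => by
      obtain ⟨hy, z, -, hz⟩ := hy
      obtain ⟨hy', z', -, hz'⟩ := hy'
      exact S.injOn_proj hy hy' (hinj (hz ▸ z.2) (hz' ▸ z'.2) he))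
  convert himg using 1
  ext x
  constructor
  · rintro ⟨z, hz, rfl⟩
    refine ⟨S.leafPoint z, ⟨S.leafPoint_mem _, ?_⟩, ?_⟩
    · exact ⟨z, hz, (S.proj_leafPoint z).symm⟩
    · simp [S.proj_leafPoint]
  · rintro ⟨y, ⟨-, z, hz, hzy⟩, rfl⟩
    exact ⟨z, hz, by simp [hzy]⟩

end Borel

section Mean

variable {M : Type*} [MeasurableSpace M] (S : InducingScheme M)

theorem lintegral_r_ne_top (μ : Measure S.Y) (hr : Integrable (fun y => (S.r y : ℝ)) μ) :
    ∫⁻ y, (S.r y : ℝ≥0∞) ∂μ ≠ ∞ := by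
  simpa using hr.lintegral_lt_top.ne

theorem lintegral_r_ne_zero (μ : Measure S.Y) [IsProbabilityMeasure μ] :
    ∫⁻ y, (S.r y : ℝ≥0∞) ∂μ ≠ 0 := by
  refine (lt_of_lt_of_le one_pos ?_).ne'
  calc (1 : ℝ≥0∞) = ∫⁻ _ : S.Y, 1 ∂μ := by simp
    _ ≤ _ := lintegral_mono fun y => Nat.one_le_cast.2 (S.r_pos y)

/-- Fubini on the tower: summing `v` over the fibre above `y` gives `V y`. Finiteness of the measure
is recorded because it makes bounded observables integrable. -/
theorem integral_muM (μ : Measure S.Y) [IsProbabilityMeasure μ]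
    (hr : Integrable (fun y => (S.r y : ℝ)) μ) {v : M → ℝ} (hv : Measurable v) {B : ℝ}
    (hB : ∀ x, ‖v x‖ ≤ B) :
    IsFiniteMeasure (S.muM μ) ∧
    ∫ x, v x ∂(S.muM μ) =
      (∫⁻ y, (S.r y : ℝ≥0∞) ∂μ)⁻¹.toReal * ∫ y, S.inducedObservable v y ∂μ := by
  have hmap : Measurable fun q : S.Y × ℕ => S.f^[q.2] (q.1 : M) :=
    measurable_from_prod_countable_left fun n => S.measurable_iterate_f n
  have hΔ : MeasurableSet {q : S.Y × ℕ | q.2 < S.r q.1} :=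
    measurableSet_lt measurable_snd (S.measurable_r.comp measurable_fst)
  have hfib : ∀ y, Prod.mk y ⁻¹' {q : S.Y × ℕ | q.2 < S.r q.1} = ↑(Finset.range (S.r y)) := by
    intro y; ext l; simp
  have hmass : (μ.prod Measure.count) {q : S.Y × ℕ | q.2 < S.r q.1} =
      ∫⁻ y, (S.r y : ℝ≥0∞) ∂μ := by
    rw [Measure.prod_apply hΔ]
    refine lintegral_congr fun y => ?_
    rw [hfib, Measure.count_apply_finset, Finset.card_range]
  have hfin := S.lintegral_r_ne_top μ hr
  have hpos := S.lintegral_r_ne_zero μ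
  have hfm : IsFiniteMeasure ((μ.prod Measure.count).restrict
      {q : S.Y × ℕ | q.2 < S.r q.1}) := ⟨by
    rw [Measure.restrict_apply_univ, hmass]; exact hfin.lt_top⟩
  have hcm : Measurable fun q : S.Y × ℕ => v (S.f^[q.2] (q.1 : M)) := hv.comp hmap
  have hint : IntegrableOn (fun q : S.Y × ℕ => v (S.f^[q.2] (q.1 : M)))
      {q : S.Y × ℕ | q.2 < S.r q.1} (μ.prod Measure.count) :=
    Integrable.of_bound hcm.aestronglyMeasurable B (Eventually.of_forall fun q => hB _)
  refine ⟨?_, ?_⟩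
  · have : IsFiniteMeasure (S.towerMeasure μ) := ⟨by
      rw [towerMeasure, Measure.smul_apply, Measure.restrict_apply_univ, hmass, smul_eq_mul,
        ENNReal.inv_mul_cancel hpos hfin]
      exact ENNReal.one_lt_top⟩
    unfold muM
    infer_instance
  · rw [muM, integral_map hmap.aemeasurable hv.aestronglyMeasurable, towerMeasure,
      integral_smul_measure, smul_eq_mul, ← integral_indicator hΔ,
      integral_prod _ ((integrable_indicator_iff hΔ).2 hint)]
    congr 1
    refine integral_congr_ae (Eventually.of_forall fun y => ?_)
    have : (fun l => {q : S.Y × ℕ | q.2 < S.r q.1}.indicator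
        (fun q : S.Y × ℕ => v (S.f^[q.2] (q.1 : M))) (y, l)) =
        (↑(Finset.range (S.r y)) : Set ℕ).indicator fun l => v (S.f^[l] (y : M)) := by
      ext l
      by_cases hl : l < S.r y <;> simp [hl]
    simp only [this]
    rw [integral_indicator (Finset.measurableSet _), setIntegral_finset]
    · simp [inducedObservable, measureReal_def]
    · have : IsFiniteMeasure (Measure.count.restrict (↑(Finset.range (S.r y)) : Set ℕ)) := ⟨by
        rw [Measure.restrict_apply_univ, Measure.count_apply_finset]
        exact ENNReal.natCast_lt_top _⟩
      exact Integrable.of_bound (measurable_of_countable _).aestronglyMeasurable B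
        (Eventually.of_forall fun q => hB _)

end Mean

end InducingScheme

/-! ### Regularity of the induced observable and of the leaf increments. -/

namespace InducingScheme

section Contraction

variable {M : Type*} [MeasurableSpace M] [MetricSpace M] (S : InducingScheme M)

theorem abs_inducedObservable_sub_le {v : M → ℝ} {c η : ℝ≥0} (hv : HolderWith c η v)
    {C γ : ℝ} (hC : 0 ≤ C) (hγ : 0 ≤ γ) {k : ℕ} {y y' : S.Y} (hr : S.r y = S.r y')
    (hd : ∀ l ≤ S.r y, dist (S.f^[l] (y : M)) (S.f^[l] (y' : M)) ≤ C * γ ^ k) :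
    |S.inducedObservable v y - S.inducedObservable v y'| ≤
      c * C ^ (η : ℝ) * (γ ^ (η : ℝ)) ^ k * S.r y := by
  have hterm : ∀ l ∈ Finset.range (S.r y), |v (S.f^[l] (y : M)) - v (S.f^[l] (y' : M))| ≤
      c * C ^ (η : ℝ) * (γ ^ (η : ℝ)) ^ k := by
    intro l hl
    have h1 := hv.dist_le_of_le (hd l (Finset.mem_range.1 hl).le)
    rw [Real.dist_eq] at h1
    refine h1.trans_eq ?_
    rw [Real.mul_rpow hC (by positivity), ← Real.rpow_natCast, ← Real.rpow_natCast,
      ← Real.rpow_mul hγ, ← Real.rpow_mul hγ, mul_comm (k : ℝ), mul_assoc]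
  unfold inducedObservable
  rw [← hr, ← Finset.sum_sub_distrib]
  refine (Finset.abs_sum_le_sum_abs _ _).trans ((Finset.sum_le_card_nsmul _ _ _ hterm).trans_eq ?_)
  rw [Finset.card_range, nsmul_eq_mul, mul_comm]

/-- Exponential contraction of the induced observable along stable leaves, and expansion along the
unstable leaf, relative to the inducing time. -/
theorem exists_inducedObservable_bounds (hA1 : S.PreservesLeaves) (hA2 : S.IsUniformlyHyperbolic)
    {v : M → ℝ} (hv : IsHolderObservable v) :
    ∃ H γ : ℝ, 0 ≤ H ∧ 0 < γ ∧ γ < 1 ∧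
      (∀ y, |S.inducedObservable v y| ≤ H * S.r y) ∧
      (∀ y y', S.stable y y' → ∀ j, |S.inducedObservable v (S.F^[j] y) -
        S.inducedObservable v (S.F^[j] y')| ≤ H * γ ^ j * S.r (S.F^[j] y)) ∧
      (∀ y ∈ S.unstable, ∀ y' ∈ S.unstable, ∀ n : ℕ, separationTime S.F S.parts y y' = n →
        ∀ j < n, |S.inducedObservable v (S.F^[j] y) - S.inducedObservable v (S.F^[j] y')| ≤
          H * γ ^ (n - j) * S.r (S.F^[j] y')) := by
  obtain ⟨C, γ₀, hC, hγ0, hγ1, hs, hu⟩ := hA2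
  obtain ⟨⟨B, hB⟩, c, η, hη0, -, hvη⟩ := hv
  have hγη1 : γ₀ ^ (η : ℝ) < 1 := Real.rpow_lt_one hγ0.le hγ1 (by exact_mod_cast hη0)
  have hC0 : 0 ≤ C := by linarith
  have hcC : 0 ≤ c * C ^ (η : ℝ) := by positivity
  refine ⟨|B| + c * C ^ (η : ℝ), γ₀ ^ (η : ℝ), by positivity, by positivity, hγη1, ?_, ?_, ?_⟩
  · intro y
    unfold inducedObservable
    refine (Finset.abs_sum_le_sum_abs _ _).trans ((Finset.sum_le_card_nsmul _ _
      (|B| + c * C ^ (η : ℝ)) fun l _ => ?_).trans_eq ?_)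
    · exact (hB _).trans ((le_abs_self B).trans (le_add_of_nonneg_right hcC))
    · rw [Finset.card_range, nsmul_eq_mul, mul_comm]
  · intro y y' hy j
    refine (S.abs_inducedObservable_sub_le hvη hC0 hγ0.le
      (S.r_eq_of_stable (stable_iterate hA1 hy j)) (hs y y' hy j)).trans ?_
    gcongr
    exact le_add_of_nonneg_left (abs_nonneg B)
  · intro y hy y' hy' n hn j hj
    -- Before separation both orbits visit the same element, so the two induced sums have equally
    -- many terms.
    obtain ⟨a, ha, hya, hya'⟩ := natCast_le_separationTime.1 hn.ge j hj
    have hr := S.r_const a ha _ hya _ hya'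
    rw [← hr]
    refine (S.abs_inducedObservable_sub_le hvη hC0 hγ0.le (k := n - j) hr fun l hl => ?_).trans ?_
    · refine (hu y hy y' hy' n hn j l hl).trans_eq ?_
      rw [← Nat.cast_sub hj.le, zpow_natCast]
    · gcongr
      exact le_add_of_nonneg_left (abs_nonneg B)

end Contraction

section Quotient

variable {M : Type*} [MeasurableSpace M] (S : InducingScheme M)

/-- The observable `V ∘ F^j` evaluated at the unstable leaf, as a function on the quotient. -/
noncomputable def leafObservable (V : S.Y → ℝ) (j : ℕ) (x : S.Ybar) : ℝ :=
  V (S.F^[j] (S.leafPoint x))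

/-- The increments whose sum is the quotient observable. -/
noncomputable def leafIncrement (hA1 : S.PreservesLeaves) (V : S.Y → ℝ) : ℕ → S.Ybar → ℝ
  | 0 => S.leafObservable V 0
  | j + 1 => fun x => S.leafObservable V (j + 1) x - S.leafObservable V j (S.Fbar hA1 x)

/-- The inducing time on the quotient. -/
noncomputable def rbar (x : S.Ybar) : ℝ := S.r (S.leafPoint x)

theorem rbar_proj (y : S.Y) : S.rbar (S.proj y) = S.r y := by
  rw [rbar, S.r_eq_of_stable (S.stable_leafPoint_proj y)]

theorem rbar_eq_of_mem_alpha {a : Set S.Ybar} (ha : a ∈ S.alpha) {x x' : S.Ybar} (hx : x ∈ a)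
    (hx' : x' ∈ a) : S.rbar x = S.rbar x' := by
  obtain ⟨b, hb, rfl⟩ := ha
  obtain ⟨y, hy, rfl⟩ := hx
  obtain ⟨y', hy', rfl⟩ := hx'
  rw [rbar_proj, rbar_proj, S.r_const b hb y hy y' hy']

variable {S}

theorem rbar_iterate (hA1 : S.PreservesLeaves) (j : ℕ) (x : S.Ybar) :
    S.rbar ((S.Fbar hA1)^[j] x) = S.r (S.F^[j] (S.leafPoint x)) := by
  conv_lhs => rw [← S.proj_leafPoint x, iterate_Fbar_proj, rbar_proj]

theorem stable_F_leafPoint (hA1 : S.PreservesLeaves) (x : S.Ybar) :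
    S.stable (S.F (S.leafPoint x)) (S.leafPoint (S.Fbar hA1 x)) := by
  rw [← S.proj_eq_iff, S.proj_leafPoint, ← Fbar_proj hA1, S.proj_leafPoint]

/-- Size comes from stable contraction, as `F (ℓ x)` and `ℓ (F̄ x)` share a leaf; regularity comes
from the estimate along `W^u`. In the constant, `2H` pays for the two terms of an increment and `H
θ⁻¹` for the index shift `θ^j = θ⁻¹ θ^{j+1}`. -/
theorem isControlled_leafIncrement (hA1 : S.PreservesLeaves) {V : S.Y → ℝ} {H γ θ : ℝ}
    (hH : 0 ≤ H) (hγ : 0 < γ) (hγθ : γ ≤ θ)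
    (hsep : ∀ x y, x ≠ y → separationTime (S.Fbar hA1) S.alpha x y ≠ ⊤)
    (hb : ∀ y, |V y| ≤ H * S.r y)
    (hs : ∀ y y', S.stable y y' → ∀ j, |V (S.F^[j] y) - V (S.F^[j] y')| ≤
      H * γ ^ j * S.r (S.F^[j] y))
    (hu : ∀ y ∈ S.unstable, ∀ y' ∈ S.unstable, ∀ n : ℕ, separationTime S.F S.parts y y' = n →
      ∀ j < n, |V (S.F^[j] y) - V (S.F^[j] y')| ≤ H * γ ^ (n - j) * S.r (S.F^[j] y'))
    (hm : ∀ j, Measurable (S.leafIncrement hA1 V j)) (j : ℕ) :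
    IsControlled (S.Fbar hA1) S.alpha θ (2 * H + H * θ⁻¹) S.rbar j (S.leafIncrement hA1 V j) := by
  have hθ : 0 < θ := hγ.trans_le hγθ
  have hθi : 0 ≤ H * θ⁻¹ := by positivity
  have hr0 : ∀ x, 0 ≤ S.rbar x := fun x => Nat.cast_nonneg _
  have hlip : ∀ j x y, (∀ i ≤ j, ∃ a ∈ S.alpha, (S.Fbar hA1)^[i] x ∈ a ∧ (S.Fbar hA1)^[i] y ∈ a) →
      |S.leafObservable V j x - S.leafObservable V j y| ≤
        H * S.rbar ((S.Fbar hA1)^[j] y) *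
          (θ⁻¹ ^ j * symbolicDist (S.Fbar hA1) S.alpha θ x y) := by
    intro j x y hxy
    rcases eq_or_ne x y with rfl | hne
    · rw [sub_self, abs_zero]
      have := hr0 ((S.Fbar hA1)^[j] x)
      have := symbolicDist_nonneg (T := S.Fbar hA1) (P := S.alpha) hθ.le x x
      positivity
    · obtain ⟨n, hn⟩ := ENat.ne_top_iff_exists.1 (hsep x y hne)
      have hjn : j < n := by
        have := natCast_le_separationTime (n := j + 1).2 fun i hi => hxy i (by omega)
        rw [← hn, Nat.cast_le] at this
        omega
      rw [symbolicDist_of_eq hn.symm, rbar_iterate]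
      have hn' : separationTime S.F S.parts (S.leafPoint x) (S.leafPoint y) = n := by
        rw [← separationTime_proj hA1, S.proj_leafPoint, S.proj_leafPoint, hn]
      refine (hu _ (S.leafPoint_mem x) _ (S.leafPoint_mem y) n hn' j hjn).trans ?_
      have h1 : θ⁻¹ ^ j * θ ^ n = θ ^ (n - j) := by
        rw [inv_pow, ← Nat.add_sub_of_le hjn.le, pow_add,
          inv_mul_cancel_left₀ (pow_pos hθ j).ne', Nat.add_sub_cancel_left]
      rw [h1, mul_right_comm]
      gcongr
  have hinv : ∀ j, θ⁻¹ * θ ^ (j + 1) = θ ^ j := fun j => by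
    rw [pow_succ', inv_mul_cancel_left₀ hθ.ne']
  refine ⟨hm j, fun x => ?_, fun x y hxy => ?_⟩
  · rcases j with _ | j
    · have h1 := hb (S.leafPoint x)
      have h2 : 0 ≤ H * S.rbar x := mul_nonneg hH (hr0 x)
      have h3 : 0 ≤ H * θ⁻¹ * S.rbar x := mul_nonneg hθi (hr0 x)
      calc |V (S.leafPoint x)| ≤ H * S.rbar x := h1
        _ ≤ (2 * H + H * θ⁻¹) * θ ^ 0 * S.rbar x := by rw [pow_zero]; linarith
    · have h1 := hs _ _ (stable_F_leafPoint hA1 x) j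
      rw [← Function.iterate_succ_apply, ← rbar_iterate hA1] at h1
      have h2 : γ ^ j ≤ θ ^ j := pow_le_pow_left₀ hγ.le hγθ j
      have h3 := hr0 ((S.Fbar hA1)^[j + 1] x)
      calc _ ≤ _ := h1
        _ ≤ H * θ ^ j * S.rbar ((S.Fbar hA1)^[j + 1] x) := by gcongr
        _ = H * θ⁻¹ * θ ^ (j + 1) * S.rbar ((S.Fbar hA1)^[j + 1] x) := by
            rw [← hinv j]; ring
        _ ≤ _ := by gcongr; linarith
  · have hd := symbolicDist_nonneg (T := S.Fbar hA1) (P := S.alpha) hθ.le x y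
    have hrj := hr0 ((S.Fbar hA1)^[j] y)
    have h0 := hlip j x y hxy
    have key : H * S.rbar ((S.Fbar hA1)^[j] y) *
          (θ⁻¹ ^ j * symbolicDist (S.Fbar hA1) S.alpha θ x y) * 2 ≤
        (2 * H + H * θ⁻¹) * S.rbar ((S.Fbar hA1)^[j] y) *
          (θ⁻¹ ^ j * symbolicDist (S.Fbar hA1) S.alpha θ x y) := by
      have : 0 ≤ H * θ⁻¹ * S.rbar ((S.Fbar hA1)^[j] y) *
          (θ⁻¹ ^ j * symbolicDist (S.Fbar hA1) S.alpha θ x y) := by positivity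
      linarith
    have hnn : 0 ≤ H * S.rbar ((S.Fbar hA1)^[j] y) *
          (θ⁻¹ ^ j * symbolicDist (S.Fbar hA1) S.alpha θ x y) := by positivity
    refine le_trans ?_ key
    rcases j with _ | j
    · exact h0.trans (by linarith)
    · have h1 := hlip j (S.Fbar hA1 x) (S.Fbar hA1 y) fun i hi => hxy (i + 1) (by omega)
      -- One step of `F̄` expands the distance by `θ⁻¹`, which matches the lower index of the second
      -- term.
      have h2 : symbolicDist (S.Fbar hA1) S.alpha θ (S.Fbar hA1 x) (S.Fbar hA1 y) =
          θ⁻¹ * symbolicDist (S.Fbar hA1) S.alpha θ x y := by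
        rw [symbolicDist_eq_mul (x := x) (y := y) (hxy 0 (Nat.zero_le _)),
          inv_mul_cancel_left₀ hθ.ne']
      rw [h2, ← mul_assoc (θ⁻¹ ^ j), ← pow_succ, ← Function.iterate_succ_apply] at h1
      have h3 : S.leafIncrement hA1 V (j + 1) x - S.leafIncrement hA1 V (j + 1) y =
          (S.leafObservable V (j + 1) x - S.leafObservable V (j + 1) y) -
          (S.leafObservable V j (S.Fbar hA1 x) - S.leafObservable V j (S.Fbar hA1 y)) := by
        simp only [leafIncrement]; ring
      rw [h3]
      exact (abs_sub _ _).trans (by linarith)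

end Quotient

end InducingScheme

/-! ### Assembling the decomposition on `Y`. -/

namespace InducingScheme

section Decomposition

variable {M : Type*} [MetricSpace M] [PolishSpace M] [MeasurableSpace M] [BorelSpace M]
  {S : InducingScheme M}

theorem measurable_leafIncrement (hA1 : S.PreservesLeaves) (hF : Measurable S.F)
    (hT : Measurable (S.Fbar hA1)) {V : S.Y → ℝ} (hV : Measurable V) (j : ℕ) :
    Measurable (S.leafIncrement hA1 V j) := by
  have h1 : ∀ j, Measurable (S.leafObservable V j) := fun j =>
    hV.comp ((hF.iterate j).comp S.measurable_leafPoint)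
  rcases j with _ | j
  · exact h1 0
  · exact (h1 (j + 1)).sub ((h1 j).comp hT)

theorem measurable_rbar : Measurable S.rbar :=
  (measurable_from_nat (f := fun n : ℕ => (n : ℝ))).comp
    (S.measurable_r.comp S.measurable_leafPoint)

/-- The quotient part of the cohomological equation: the increments sum, up to constants, to a
martingale difference plus a coboundary. -/
theorem exists_hasSum_leafIncrement {μ : Measure S.Y} [IsProbabilityMeasure μ]
    (hF : Measurable S.F) (hA1 : S.PreservesLeaves) (hA3 : S.QuotientMixingGibbsMarkov hA1 μ)
    {p : ℝ≥0∞} [Fact (1 ≤ p)] (hr : MemLp (fun y => (S.r y : ℝ)) p μ)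
    (hT : MeasurePreserving (S.Fbar hA1) (S.muBar μ) (S.muBar μ))
    {V : S.Y → ℝ} (hVm : Measurable V) {H γ : ℝ}
    (hH : 0 ≤ H) (hγ : 0 < γ) (hγ1 : γ < 1) (hb : ∀ y, |V y| ≤ H * S.r y)
    (hs : ∀ y y', S.stable y y' → ∀ j, |V (S.F^[j] y) - V (S.F^[j] y')| ≤
      H * γ ^ j * S.r (S.F^[j] y))
    (hu : ∀ y ∈ S.unstable, ∀ y' ∈ S.unstable, ∀ n : ℕ, separationTime S.F S.parts y y' = n →
      ∀ j < n, |V (S.F^[j] y) - V (S.F^[j] y')| ≤ H * γ ^ (n - j) * S.r (S.F^[j] y')) :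
    ∃ (c : ℕ → ℝ) (hW : ∀ j, MemLp (fun x => S.leafIncrement hA1 V j x - c j) p (S.muBar μ))
      (m χ : Lp ℝ p (S.muBar μ)), Summable c ∧
      HasSum (fun j => (hW j).toLp _) (m + Lp.compMeasurePreserving (S.Fbar hA1) hT χ - χ) ∧
      transferOperator (S.Fbar hA1) (S.muBar μ) m =ᵐ[S.muBar μ] 0 := by
  have hp : (1 : ℝ≥0∞) ≤ p := Fact.out
  have hπ : MeasurePreserving S.proj μ (S.muBar μ) := S.measurable_proj.measurePreserving μ
  have hprob : IsProbabilityMeasure (S.muBar μ) := hA3.1.isProbabilityMeasure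
  obtain ⟨θ, K, δ, g, hγθ, hG⟩ := hA3.1.exists_isGibbsMap (fun a ha =>
    S.measurableEmbedding_restrict_Fbar hA1 (hA3.1.measurableSet a ha) hT.measurable
      (hA3.1.injOn a ha)) hγ1
  have hrb : MemLp S.rbar p (S.muBar μ) := by
    rw [← hπ.map_eq, memLp_map_measure_iff measurable_rbar.aestronglyMeasurable hπ.aemeasurable]
    exact hr.ae_eq (Eventually.of_forall fun y => (S.rbar_proj y).symm)
  have hcon := isControlled_leafIncrement hA1 hH hγ hγθ hA3.1.separates hb hs hu
    (measurable_leafIncrement hA1 hF hT.measurable hVm)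
  have hB : 0 ≤ 2 * H + H * θ⁻¹ := by
    have := hG.theta_pos
    positivity
  obtain ⟨C, ν, hC, hν0, hν1, hbound⟩ := hG.exists_eLpNorm_transferOperator_le hA3.2
    (fun x => Nat.cast_nonneg _) (fun a ha x hx y hy => S.rbar_eq_of_mem_alpha ha hx hy)
    measurable_rbar hp hrb hB
  have hri := hrb.integrable hp
  have hU : ∀ j, MemLp (S.leafIncrement hA1 V j) p (S.muBar μ) := fun j => by
    have h1 : MemLp (fun x => S.rbar ((S.Fbar hA1)^[j] x)) p (S.muBar μ) :=
      hrb.comp_measurePreserving (hT.iterate j)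
    refine h1.of_le_mul (c := (2 * H + H * θ⁻¹) * θ ^ j) (hcon j).measurable.aestronglyMeasurable
      (Eventually.of_forall fun x => ?_)
    rw [Real.norm_of_nonneg (show 0 ≤ S.rbar ((S.Fbar hA1)^[j] x) from Nat.cast_nonneg _)]
    exact (hcon j).abs_le x
  obtain ⟨m, χ, h1, h2⟩ := exists_martingale_coboundary hT
    (fun j => (hU j).sub (memLp_const (∫ x, S.leafIncrement hA1 V j x ∂(S.muBar μ))))
    hC hν0 hν1 fun n j => hbound j _ (hcon j) n
  refine ⟨fun j => ∫ x, S.leafIncrement hA1 V j x ∂(S.muBar μ),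
    fun j => (hU j).sub (memLp_const _), m, χ, ?_, h1, h2⟩
  refine Summable.of_norm_bounded (g := fun j => (2 * H + H * θ⁻¹) * θ ^ j *
    ∫ x, S.rbar x ∂(S.muBar μ)) ?_ fun j => hG.abs_integral_le_of_isControlled hri (hcon j)
  exact ((summable_geometric_of_lt_one hG.theta_pos.le hG.theta_lt_one).mul_left _).mul_right _

/-- The martingale-coboundary decomposition of a centred real observable. -/
theorem exists_decomposition {μ : Measure S.Y} [IsProbabilityMeasure μ]
    (hF : MeasurePreserving S.F μ μ) (hA1 : S.PreservesLeaves)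
    (hA2 : S.IsUniformlyHyperbolic) (hA3 : S.QuotientMixingGibbsMarkov hA1 μ)
    {v : M → ℝ} (hv : IsHolderObservable v) (hvm : Measurable v)
    (hmean : ∫ y, S.inducedObservable v y ∂μ = 0) {p : ℝ≥0∞} (hp : 1 ≤ p)
    (hr : MemLp (fun y => (S.r y : ℝ)) p μ) :
    ∃ (m : S.Ybar → ℝ) (χ : S.Y → ℝ), MemLp m p (S.muBar μ) ∧ MemLp χ p μ ∧
      (∀ᵐ y ∂μ, S.inducedObservable v y = m (S.proj y) + χ (S.F y) - χ y) ∧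
      transferOperator (S.Fbar hA1) (S.muBar μ) m =ᵐ[S.muBar μ] 0 := by
  have hfact : Fact (1 ≤ p) := ⟨hp⟩
  have hπ : MeasurePreserving S.proj μ (S.muBar μ) := S.measurable_proj.measurePreserving μ
  have hprob : IsProbabilityMeasure (S.muBar μ) := hA3.1.isProbabilityMeasure
  have hT := hA3.1.ergodic.toMeasurePreserving
  have hVm := S.measurable_inducedObservable hvm
  obtain ⟨H, γ, hH, hγ, hγ1, hb, hs, hu⟩ := S.exists_inducedObservable_bounds hA1 hA2 hv
  generalize S.inducedObservable v = V at *
  obtain ⟨c, hW, m, χ, hc, hsum, hm⟩ := exists_hasSum_leafIncrement hF.measurable hA1 hA3 hr hT hVm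
    hH hγ hγ1 hb hs hu
  let κπ : Lp ℝ p (S.muBar μ) →L[ℝ] Lp ℝ p μ :=
    (Lp.compMeasurePreservingₗᵢ ℝ S.proj hπ).toContinuousLinearMap
  let κF : Lp ℝ p μ →L[ℝ] Lp ℝ p μ :=
    (Lp.compMeasurePreservingₗᵢ ℝ S.F hF).toContinuousLinearMap
  have hrj : ∀ j, MemLp (fun y => (S.r (S.F^[j] y) : ℝ)) p μ := fun j =>
    hr.comp_measurePreserving (hF.iterate j)
  have hVj : ∀ j, Measurable fun y => V (S.F^[j] y) := fun j =>
    hVm.comp (hF.measurable.iterate j)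
  have hVp : MemLp V p μ := hr.of_le_mul hVm.aestronglyMeasurable
    (Eventually.of_forall fun y => by
      rw [Real.norm_of_nonneg (show (0 : ℝ) ≤ S.r y from Nat.cast_nonneg _)]
      exact hb y)
  have hdiff : ∀ j y, ‖S.leafObservable V j (S.proj y) - V (S.F^[j] y)‖ ≤
      H * γ ^ j * ‖(S.r (S.F^[j] y) : ℝ)‖ := fun j y => by
    have h1 := S.stable_leafPoint_proj y
    have h2 := hs _ _ h1 j
    rw [S.r_eq_of_stable (stable_iterate hA1 h1 j)] at h2
    rwa [Real.norm_of_nonneg (Nat.cast_nonneg _)]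
  have ha : ∀ j, MemLp (fun y => S.leafObservable V j (S.proj y) - V (S.F^[j] y)) p μ := fun j =>
    (hrj j).of_le_mul (((hVj j).comp (S.measurable_leafPoint.comp S.measurable_proj)).sub
      (hVj j)).aestronglyMeasurable (Eventually.of_forall (hdiff j))
  let a : ℕ → Lp ℝ p μ := fun j => (ha j).toLp _
  have hanorm : ∀ j, ‖a j‖ ≤ H * γ ^ j * (eLpNorm (fun y => (S.r y : ℝ)) p μ).toReal := fun j => by
    have h1 := eLpNorm_le_mul_eLpNorm_of_ae_le_mul (Eventually.of_forall (hdiff j)) p (μ := μ)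
    have h2 : eLpNorm (fun y => (S.r (S.F^[j] y) : ℝ)) p μ = eLpNorm (fun y => (S.r y : ℝ)) p μ :=
      eLpNorm_comp_measurePreserving (f := S.F^[j]) (g := fun y => (S.r y : ℝ)) hr.1
        (hF.iterate j)
    rw [h2] at h1
    have h3 := ENNReal.toReal_mono (ENNReal.mul_ne_top ENNReal.ofReal_ne_top hr.eLpNorm_ne_top) h1
    rw [ENNReal.toReal_mul, ENNReal.toReal_ofReal (by positivity)] at h3
    rwa [Lp.norm_toLp]
  have hasum : Summable a := Summable.of_norm_bounded
    (((summable_geometric_of_lt_one hγ.le hγ1).mul_left H).mul_right _) hanorm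
  set χ₁ := ∑' j, a j with hχ₁
  -- With the constants restored, the lifted increments telescope: `U_0 ∘ π = a_0 + V` and `U_{j+1}
  -- ∘ π = a_{j+1} - a_j ∘ F`.
  have hlift : ∀ j, κπ ((hW j).toLp _) + Lp.constL p μ ℝ (c j) =
      match j with
      | 0 => a 0 + hVp.toLp V
      | j + 1 => a (j + 1) - κF (a j) := by
    intro j
    have h1 : κπ ((hW j).toLp _) =ᵐ[μ] fun y => S.leafIncrement hA1 V j (S.proj y) - c j :=
      ((hW j).comp_measurePreserving hπ).coeFn_toLp
    have h2 : (Lp.constL p μ ℝ (c j) : Lp ℝ p μ) =ᵐ[μ] fun _ => c j := Lp.coeFn_const p μ (c j)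
    rcases j with _ | j
    · refine Lp.ext ?_
      filter_upwards [h1, h2, Lp.coeFn_add (κπ ((hW 0).toLp _)) (Lp.constL p μ ℝ (c 0)),
        Lp.coeFn_add (a 0) (hVp.toLp V), (ha 0).coeFn_toLp, hVp.coeFn_toLp]
        with y e1 e2 e3 e4 e5 e6
      rw [e3, e4, Pi.add_apply, Pi.add_apply, e1, e2, e5, e6]
      simp [leafIncrement]
    · have h3 : κF (a j) =ᵐ[μ] fun y =>
          S.leafObservable V j (S.proj (S.F y)) - V (S.F^[j] (S.F y)) :=
        ((ha j).comp_measurePreserving hF).coeFn_toLp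
      refine Lp.ext ?_
      filter_upwards [h1, h2, h3, Lp.coeFn_add (κπ ((hW (j + 1)).toLp _))
        (Lp.constL p μ ℝ (c (j + 1))), Lp.coeFn_sub (a (j + 1)) (κF (a j)),
        (ha (j + 1)).coeFn_toLp] with y e1 e2 e3 e4 e5 e6
      rw [e4, e5, Pi.add_apply, Pi.sub_apply, e1, e2, e3, e6]
      simp [leafIncrement, Fbar_proj]
  have hs1 := (hsum.mapL κπ).add (hc.hasSum.mapL (Lp.constL p μ ℝ))
  have hs2 : HasSum (fun j => κπ ((hW j).toLp _) + Lp.constL p μ ℝ (c j))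
      (a 0 + hVp.toLp V + (χ₁ - a 0 - κF χ₁)) := by
    have h1 : HasSum (fun j => κπ ((hW (j + 1)).toLp _) + Lp.constL p μ ℝ (c (j + 1)))
        (χ₁ - a 0 - κF χ₁) := by
      simp only [fun j => hlift (j + 1)]
      have h2 := (hasSum_nat_add_iff' 1).2 hasum.hasSum
      rw [Finset.sum_range_one] at h2
      exact h2.sub (hasum.hasSum.mapL κF)
    have h3 := HasSum.zero_add (f := fun j => κπ ((hW j).toLp _) + Lp.constL p μ ℝ (c j)) h1
    rwa [hlift 0] at h3
  -- The same series in `L^p(Y)`, summed through the quotient decomposition and through the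
  -- telescoping.
  have heq := hs1.unique hs2
  have hcomm : κπ (Lp.compMeasurePreserving (S.Fbar hA1) hT χ) = κF (κπ χ) :=
    (Lp.compMeasurePreserving_comp_apply χ hT hπ).symm.trans
      (Lp.compMeasurePreserving_comp_apply χ hπ hF)
  rw [map_sub, map_add, hcomm] at heq
  -- The transfer function joins the quotient one, lifted by `π`, to the one produced by sliding
  -- along stable leaves.
  have hV : hVp.toLp V = κπ m + κF (κπ χ + χ₁) - (κπ χ + χ₁) + Lp.constL p μ ℝ (∑' j, c j) := by
    rw [map_add]
    have h1 : hVp.toLp V = (a 0 + hVp.toLp V + (χ₁ - a 0 - κF χ₁)) - χ₁ + κF χ₁ := by abel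
    rw [h1, ← heq]
    abel
  have hae : ∀ᵐ y ∂μ, V y = m (S.proj y) + (κπ χ + χ₁ : Lp ℝ p μ) (S.F y) -
      (κπ χ + χ₁ : Lp ℝ p μ) y + ∑' j, c j := by
    generalize κπ χ + χ₁ = X at hV ⊢
    have h1 : κπ m =ᵐ[μ] fun y => m (S.proj y) := Lp.coeFn_compMeasurePreserving m hπ
    have h2 : κF X =ᵐ[μ] fun y => X (S.F y) := Lp.coeFn_compMeasurePreserving X hF
    have h3 : (Lp.constL p μ ℝ (∑' j, c j) : Lp ℝ p μ) =ᵐ[μ] fun _ => ∑' j, c j :=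
      Lp.coeFn_const p μ _
    have h4 := hVp.coeFn_toLp
    rw [hV] at h4
    filter_upwards [h1, h2, h3, h4, Lp.coeFn_add (κπ m + κF X - X) (Lp.constL p μ ℝ (∑' j, c j)),
      Lp.coeFn_sub (κπ m + κF X) X, Lp.coeFn_add (κπ m) (κF X)] with y e1 e2 e3 e4 e5 e6 e7
    rw [← e4, e5, Pi.add_apply, e6, Pi.sub_apply, e7, Pi.add_apply, e1, e2, e3]
  generalize (κπ χ + χ₁ : Lp ℝ p μ) = X at hae
  have hmi : Integrable m (S.muBar μ) := (Lp.memLp m).integrable hp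
  have hXi : Integrable X μ := (Lp.memLp X).integrable hp
  have hm0 : ∫ x, m x ∂(S.muBar μ) = 0 := by
    have h1 := setIntegral_transferOperator hT hmi MeasurableSet.univ
    rw [preimage_univ, setIntegral_univ, setIntegral_univ, integral_congr_ae hm] at h1
    simpa using h1.symm
  -- Integrate the identity: `V` and `m` have mean zero and the coboundary integrates to zero.
  have hc0 : ∑' j, c j = 0 := by
    have hmπ : Integrable (fun y => m (S.proj y)) μ := (hπ.integrable_comp hmi.1).2 hmi
    have hXF : Integrable (fun y => X (S.F y)) μ := (hF.integrable_comp hXi.1).2 hXi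
    have h1 : ∫ y, m (S.proj y) ∂μ = ∫ x, m x ∂(S.muBar μ) :=
      (integral_map hπ.aemeasurable hmi.1).symm
    have h2 : ∫ y, X (S.F y) ∂μ = ∫ y, X y ∂μ := by
      have := integral_map (μ := μ) (f := X) hF.aemeasurable (by rw [hF.map_eq]; exact hXi.1)
      rw [hF.map_eq] at this
      exact this.symm
    have h3 : ∫ y, (m (S.proj y) + X (S.F y) - X y) ∂μ = 0 := by
      have h4 : Integrable (fun y => m (S.proj y) + X (S.F y)) μ := hmπ.add hXF
      rw [integral_sub h4 hXi, integral_add hmπ hXF, h1, h2, hm0]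
      ring
    have h5 : Integrable (fun y => m (S.proj y) + X (S.F y) - X y) μ := (hmπ.add hXF).sub hXi
    rw [integral_congr_ae hae, integral_add h5 (integrable_const _), h3] at hmean
    simpa using hmean
  refine ⟨m, X, Lp.memLp m, Lp.memLp X, ?_, hm⟩
  filter_upwards [hae] with y hy
  rw [hy, hc0, add_zero]

end Decomposition

end InducingScheme

/-! ### Reduction of the vector-valued statement to coordinates. -/

theorem IsHolderObservable.eval {M : Type*} [MetricSpace M] {d : ℕ}
    {v : M → EuclideanSpace ℝ (Fin d)} (hv : IsHolderObservable v) (i : Fin d) :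
    IsHolderObservable fun x => v x i := by
  obtain ⟨⟨B, hB⟩, C, η, h0, h1, hC⟩ := hv
  refine ⟨⟨B, fun x => (PiLp.norm_apply_le (v x) i).trans (hB x)⟩, C, η, h0, h1, fun x y => ?_⟩
  refine le_trans ?_ (hC x y)
  rw [edist_dist, edist_dist, dist_eq_norm, dist_eq_norm]
  exact ENNReal.ofReal_le_ofReal (PiLp.norm_apply_le (v x - v y) i)

theorem mainTheorem1 {M : Type*} [MetricSpace M] [PolishSpace M] [MeasurableSpace M] [BorelSpace M]
    (S : InducingScheme M)
    (μ : Measure S.Y) [IsProbabilityMeasure μ] (hμ : Ergodic S.F μ)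
    (hA1 : S.PreservesLeaves)
    (hA2 : S.IsUniformlyHyperbolic)
    (hA3 : S.QuotientMixingGibbsMarkov hA1 μ)
    (hA4 : Integrable (fun y => (S.r y : ℝ)) μ)
    {d : ℕ} (v : M → EuclideanSpace ℝ (Fin d)) (hv : IsHolderObservable v)
    (hv_mean : ∫ x, v x ∂(S.muM μ) = 0)
    (p : ℝ≥0∞) (hp : 1 ≤ p) (hp_top : p ≠ ∞)
    (hr : MemLp (fun y => (S.r y : ℝ)) p μ) :
    ∃ (m : S.Ybar → EuclideanSpace ℝ (Fin d)) (χ : S.Y → EuclideanSpace ℝ (Fin d)),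
      MemLp m p (S.muBar μ) ∧ MemLp χ p μ ∧
      (∀ᵐ y ∂μ, S.inducedObservable v y = m (S.proj y) + χ (S.F y) - χ y) ∧
      vectorTransferOperator (S.Fbar hA1) (S.muBar μ) m =ᵐ[S.muBar μ] 0 := by
  have hvi := fun i => hv.eval i
  have hvc : Continuous v := by
    obtain ⟨-, C, η, h0, -, hC⟩ := hv
    exact hC.continuous h0
  have hvm : ∀ i, Measurable fun x => v x i := fun i => by
    have : Continuous fun x => v x i := by fun_prop
    exact this.measurable
  have hmean : ∀ i, ∫ y, S.inducedObservable (fun x => v x i) y ∂μ = 0 := by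
    intro i
    have hint : ∀ i, Integrable (fun x => v x i) (S.muM μ) := fun i => by
      obtain ⟨B, hB⟩ := (hvi i).1
      have := (S.integral_muM μ hA4 (hvm i) hB).1
      exact Integrable.of_bound (hvm i).aestronglyMeasurable B (Eventually.of_forall hB)
    obtain ⟨B, hB⟩ := (hvi i).1
    have h1 := (S.integral_muM μ hA4 (hvm i) hB).2
    rw [← eval_integral_piLp hint, hv_mean] at h1
    -- The normalising factor `1 / ∫ r` is positive and finite, so the centring of `v` passes to
    -- `V`.
    refine (mul_eq_zero.1 h1.symm).resolve_left ?_
    exact (ENNReal.toReal_pos (ENNReal.inv_ne_zero.2 (S.lintegral_r_ne_top μ hA4))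
      (ENNReal.inv_ne_top.2 (S.lintegral_r_ne_zero μ))).ne'
  choose m χ hm hχ hdec htr using fun i => InducingScheme.exists_decomposition
    hμ.toMeasurePreserving hA1 hA2 hA3 (hvi i) (hvm i) (hmean i) hp hr
  refine ⟨fun x => WithLp.toLp 2 fun i => m i x, fun y => WithLp.toLp 2 fun i => χ i y,
    MemLp.of_eval_piLp hm, MemLp.of_eval_piLp hχ, ?_, ?_⟩
  · filter_upwards [ae_all_iff.2 hdec] with y hy
    ext i
    have h1 : S.inducedObservable v y i = S.inducedObservable (fun x => v x i) y := by
      simp [InducingScheme.inducedObservable]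
    rw [h1, hy i]
    simp
  · filter_upwards [ae_all_iff.2 htr] with x hx
    ext i
    exact hx i
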